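/- Let $\mathbb{F}_q$ be a finite field and $C \subseteq \mathbb{F}_q^n$ a linear code with minimum Hamming distance $d_{\min}(C)$ (the minimum of $d(c,c')$ over distinct $c,c'\in C$, and $\infty$ if $|C|=1$). Call $C$ $(p,L)$-list-decodable if $|\{c\in C : d(w,c)\le pn\}|\le L$ for every $w\in\mathbb{F}_q^n$. In the $q$-ary symmetric channel qSC$_{p'}$, each transmitted symbol is, independently, left unchanged with probability $1-p'$ and otherwise replaced by a uniformly random different symbol of $\mathbb{F}_q$. A randomized decoder for $C$ is a probability distribution over the functions $D:\mathbb{F}_q^n\to C$. Theorem. For every $p\in(0,1)$ there are a number $n_0$ and a sequence $\varepsilon_n\to 0$, both depending only on $p$, such that the following holds for every $n\ge n_0$. Put $p' = p-\frac{7}{\ln n}$; then $0\le p'\le 1$. For every finite field $\mathbb{F}_q$, every real $L$, and every linear $(p,L)$-list-decodable code $C\subseteq\mathbb{F}_q^n$ with $$d_{\min}(C)\ \ge\ \frac{q^3}{(1-p)^2}\,\ln^4(nL),$$ there is a randomized decoder $D$ for $C$, independent of the channel, such that every codeword $c\in C$, sent through qSC$_{p'}$ and received as $\tilde c$, satisfies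 $\Pr[D(\tilde c)=c]\ge 1-\varepsilon_n$. That is, $C$ admits reliable communication on qSC$_{p'}$. -/

import Mathlib

open scoped ENNReal

namespace CodingTheory

noncomputable section

/-- The minimum distance of a code `C ⊆ F^n`: the minimum of the Hamming distance over all pairs
of distinct codewords. (It is `⊤` for a code with a single codeword.) -/
def minDist {F : Type*} [Field F] [DecidableEq F] {n : ℕ} (C : Submodule F (Fin n → F)) : ℕ∞ :=
  ⨅ c ∈ C, ⨅ c' ∈ C, ⨅ _ : c ≠ c', (hammingDist c c' : ℕ∞)

/-- `C ⊆ F^n` is `(p, L)`-list-decodable: every Hamming ball of radius `p * n` contains at most `L`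
codewords. -/
def IsListDecodable {F : Type*} [Field F] [Fintype F] [DecidableEq F] {n : ℕ}
    (C : Submodule F (Fin n → F)) (p L : ℝ) : Prop :=
  ∀ w : Fin n → F, (Set.ncard {c : Fin n → F | c ∈ C ∧ (hammingDist w c : ℝ) ≤ p * n} : ℝ) ≤ L

/-- One use of the `q`-ary symmetric channel with parameter `p` on the input symbol `x`, where
`q = |F|`: the output is `x` with probability `1 - p`, and each of the `q - 1` other symbols with
probability `p / (q - 1)`. -/
def qscSymbol {F : Type*} [Field F] [Fintype F] [DecidableEq F] (p : ℝ)
    (hp : p ∈ Set.Icc (0 : ℝ) 1) (x : F) : PMF F :=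
  PMF.ofFintype
    (fun y => if y = x then ENNReal.ofReal (1 - p)
      else ENNReal.ofReal (p / ((Fintype.card F : ℝ) - 1)))
    (by
      have hq : (1 : ℝ) < Fintype.card F := by exact_mod_cast Fintype.one_lt_card
      have h0 : (0 : ℝ) ≤ p / ((Fintype.card F : ℝ) - 1) :=
        div_nonneg hp.1 (by linarith)
      have h1 : (0 : ℝ) ≤ 1 - p := by linarith [hp.2]
      have hterm : ∀ y : F, (if y = x then ENNReal.ofReal (1 - p)
          else ENNReal.ofReal (p / ((Fintype.card F : ℝ) - 1)))
          = ENNReal.ofReal (if y = x then 1 - p else p / ((Fintype.card F : ℝ) - 1)) := by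
        intro y; split_ifs <;> rfl
      simp_rw [hterm]
      rw [← ENNReal.ofReal_sum_of_nonneg (by intro y _; split_ifs <;> assumption),
        ← ENNReal.ofReal_one]
      congr 1
      rw [← Finset.add_sum_erase _ _ (Finset.mem_univ x), if_pos rfl,
        Finset.sum_congr rfl (g := fun _ => p / ((Fintype.card F : ℝ) - 1))
          (fun y hy => if_neg (Finset.ne_of_mem_erase hy)),
        Finset.sum_const, Finset.card_erase_of_mem (Finset.mem_univ x), Finset.card_univ,
        nsmul_eq_mul, Nat.cast_sub Fintype.card_pos, Nat.cast_one,
        mul_div_cancel₀ _ (by linarith : (Fintype.card F : ℝ) - 1 ≠ 0)]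
      ring)

/-- The `q`-ary symmetric channel with parameter `p`, used on a vector `x ∈ F^n`: the law of the
received vector, whose coordinates are independent. -/
def qsc {F : Type*} [Field F] [Fintype F] [DecidableEq F] {n : ℕ} (p : ℝ)
    (hp : p ∈ Set.Icc (0 : ℝ) 1) (x : Fin n → F) : PMF (Fin n → F) :=
  PMF.ofFintype (fun y => ∏ i, qscSymbol p hp (x i) (y i))
    (by
      rw [← Fintype.prod_sum fun i a => qscSymbol p hp (x i) a]
      refine Finset.prod_eq_one fun i _ => ?_
      rw [← tsum_fintype (L := .unconditional _)]
      exact (qscSymbol p hp (x i)).tsum_coe)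

/-- A randomized decoder for `C`: a probability distribution over the set of functions
`F^n → C`. -/
abbrev RandomizedDecoder {F : Type*} [Field F] {n : ℕ} (C : Submodule F (Fin n → F)) :=
  PMF ((Fin n → F) → C)

/-- The probability that the randomized decoder `D` outputs `c` when `c` is sent through the
`q`-ary symmetric channel with parameter `p`; the decoder and the channel are independent. -/
def successProb {F : Type*} [Field F] [Fintype F] [DecidableEq F] {n : ℕ}
    {C : Submodule F (Fin n → F)} (D : RandomizedDecoder C) (p : ℝ)
    (hp : p ∈ Set.Icc (0 : ℝ) 1) (c : C) : ℝ≥0∞ :=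
  (D.bind fun d => (qsc p hp (c : Fin n → F)).map d) c

/-- `C` admits communication over the `q`-ary symmetric channel with parameter `p` with error
probability at most `ε`: some randomized decoder recovers every transmitted codeword with
probability at least `1 - ε`. -/
def AdmitsCommunication {F : Type*} [Field F] [Fintype F] [DecidableEq F] {n : ℕ}
    (C : Submodule F (Fin n → F)) (p : ℝ) (hp : p ∈ Set.Icc (0 : ℝ) 1) (ε : ℝ) : Prop :=
  ∃ D : RandomizedDecoder C, ∀ c : C, ENNReal.ofReal (1 - ε) ≤ successProb D p hp c

end

end CodingTheory

/-! By linearity it suffices to find a set `G` of error vectors of probability at least `1 - 1/n`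
that meets each coset of `C` at most once; the decoder is then deterministic
(`admitsCommunication_of_coset_unique`). Write `q = |F|`, `N = n * L`, and `|c|` for the Hamming
weight.

If `p ≤ 1 - 1/q`, take for `G` the vectors strictly closer to `0` than to every other codeword. At
noise level `p - 1/ln n`, Markov's inequality puts the error in the ball of radius `p * n` with
probability at least `1/ln n`. The ball meets each coset in at most `L` points, none more likely
than a coset leader, so with probability at least `1/N` the error has minimum weight in its coset
(`sum_wordWeight_le_mul_of_isListDecodable`).

This small probability is amplified in two steps. Lowering the noise to `p'` turns the weak
preference for `0` into a margin of order `√(|c| ln N)` against every nonzero codeword `c`, at a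
loss of `N⁻²` (`sum_wordWeight_le_margin`). The preference over `c` depends only on the coordinates
in the support of `c`, and each of them changes it by at most 2. So, by Talagrand's inequality
(`exists_differenceHull`), vectors outside `G` are far from the margin event in convex distance and
have probability at most `2 * N * N⁻⁴` (`sum_margin_mul_le`). No union bound over the code is taken,
hence a distance polylogarithmic in `N` is enough.

If `p > 1 - 1/q`, a ball of radius `p * n` holds a constant fraction of the space, so `|C| ≤ N` for
large `n`. Each wrong symbol is likelier than the right one, and a union bound shows that the
transmitted word is the farthest codeword (`admitsCommunication_of_gap`). -/

namespace CodingTheory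

/-! ### Talagrand's convex distance inequality -/

/-- In the vicinity of `r = 1`, the exponent `l = 2 * r - 1` makes the Hölder step in the induction
for the convex distance work. -/
theorem convexDistance_exponent_le {r : ℝ} (h1 : 1 / 2 ≤ r) (h2 : r ≤ 1) :
    (1 - (2 * r - 1)) ^ 2 / 4 - (2 * r - 1) * Real.log r ≤ Real.log (2 - r) := by
  have hr : 0 < r := by linarith
  -- Both logarithms are replaced by rational bounds, the first from `u ≤ sinh u` at `u = -log r`.
  -- Once the denominator `3 - r` is cleared, the slack is `3 (1 - r)³ / (2 r)`.
  have hlog : -Real.log r ≤ (r⁻¹ - r) / 2 := by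
    have h := Real.self_le_sinh_iff.2 (Real.log_nonneg ((one_le_inv₀ hr).2 h2))
    rwa [Real.sinh_log (inv_pos.2 hr), inv_inv, Real.log_inv] at h
  have hlog2 : 2 * (1 - r) / ((1 - r) + 2) ≤ Real.log (1 + (1 - r)) :=
    Real.le_log_one_add_of_nonneg (by linarith)
  have key : (1 - r) ^ 2 + (2 * r - 1) * ((r⁻¹ - r) / 2) ≤ 2 * (1 - r) / ((1 - r) + 2) := by
    rw [le_div_iff₀ (by linarith), ← sub_nonneg]
    have : 2 * (1 - r) - ((1 - r) ^ 2 + (2 * r - 1) * ((r⁻¹ - r) / 2)) * (1 - r + 2)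
        = 3 * (1 - r) ^ 3 / (2 * r) := by
      field_simp
      ring
    rw [this]
    have : 0 ≤ 1 - r := by linarith
    positivity
  have := mul_le_mul_of_nonneg_left hlog (by linarith : 0 ≤ 2 * r - 1)
  rw [show (2 : ℝ) - r = 1 + (1 - r) by ring]
  linarith

/-- `v` lies above a convex combination of the indicator vectors of the coordinates in which `x`
differs from a point of `A`. This is expressed in dual form, by nonnegative weights. -/
def DifferenceHull {F : Type*} [DecidableEq F] {n : ℕ} (A : Finset (Fin n → F)) (x : Fin n → F)
    (v : Fin n → ℝ) : Prop :=
  ∀ w : Fin n → ℝ, (∀ i, 0 ≤ w i) →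
    ∃ y ∈ A, ∑ i, w i * (if y i = x i then 0 else 1) ≤ ∑ i, w i * v i

/-- For given weights the combination scores at least the smaller of the two scores, so the point of
`A` that serves the smaller one serves it too. -/
theorem DifferenceHull.convex {F : Type*} [DecidableEq F] {n : ℕ} {A : Finset (Fin n → F)}
    {x : Fin n → F} {u v : Fin n → ℝ} (hu : DifferenceHull A x u) (hv : DifferenceHull A x v)
    {l : ℝ} (h0 : 0 ≤ l) (h1 : l ≤ 1) :
    DifferenceHull A x (fun i => l * u i + (1 - l) * v i) := by
  intro w hw
  obtain ⟨y, hy, hyu⟩ := hu w hw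
  obtain ⟨z, hz, hzv⟩ := hv w hw
  have e : ∑ i, w i * (l * u i + (1 - l) * v i)
      = l * ∑ i, w i * u i + (1 - l) * ∑ i, w i * v i := by
    rw [Finset.mul_sum, Finset.mul_sum, ← Finset.sum_add_distrib]
    exact Finset.sum_congr rfl fun i _ => by ring
  rw [e]
  rcases le_total (∑ i, w i * u i) (∑ i, w i * v i) with h | h
  · exact ⟨y, hy, by nlinarith⟩
  · exact ⟨z, hz, by nlinarith⟩

theorem sum_cons {F : Type*} [Fintype F] {n : ℕ} (f : (Fin (n + 1) → F) → ℝ) :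
    ∑ x, f x = ∑ a : F, ∑ z : Fin n → F, f (Fin.cons a z) := by
  rw [← (Fin.consEquiv fun _ : Fin (n + 1) => F).sum_comp, Fintype.sum_prod_type]
  rfl

/-- Talagrand's convex distance inequality on a finite product space. -/
theorem exists_differenceHull {F : Type*} [Fintype F] [DecidableEq F] (m : F → ℝ)
    (hm : ∀ a, 0 ≤ m a) (hs : ∑ a, m a = 1) (n : ℕ) :
    ∀ A : Finset (Fin n → F), A.Nonempty → ∃ v : (Fin n → F) → Fin n → ℝ,
      (∀ x, DifferenceHull A x (v x)) ∧
      (∑ y ∈ A, ∏ i, m (y i)) * ∑ x, (∏ i, m (x i)) * Real.exp ((∑ i, v x i ^ 2) / 4) ≤ 1 := by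
  induction n with
  | zero =>
    intro A hA
    refine ⟨fun _ _ => 0, fun x w _ => ⟨hA.choose, hA.choose_spec, by simp⟩, ?_⟩
    have : A.card ≤ 1 := by
      simpa using Finset.card_le_univ A
    simp [this]
  | succ n ih =>
    intro A hA
    -- A point `Fin.cons a z` can be compared with the projection `B`, paying 1 in the first
    -- coordinate, or with the fibre `Af a`, paying nothing there. The fibre is closer but has the
    -- smaller weight, `α a ≤ b`.
    set B : Finset (Fin n → F) := A.image Fin.tail with hB
    have hBne : B.Nonempty := hA.image _
    set P : (Fin n → F) → ℝ := fun z => ∏ i, m (z i) with hP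
    have hP0 : ∀ z, 0 ≤ P z := fun z => Finset.prod_nonneg fun i _ => hm _
    have hcons : ∀ a z, (∏ i, m ((Fin.cons a z : Fin (n + 1) → F) i)) = m a * P z := by
      intro a z
      rw [Fin.prod_univ_succ]
      simp [hP]
    set b : ℝ := ∑ z ∈ B, P z with hb
    have hb0 : 0 ≤ b := Finset.sum_nonneg fun z _ => hP0 z
    let Af : F → Finset (Fin n → F) := fun a =>
      Finset.univ.filter fun z => (Fin.cons a z : Fin (n + 1) → F) ∈ A
    have hAf : ∀ a z, z ∈ Af a ↔ (Fin.cons a z : Fin (n + 1) → F) ∈ A := by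
      intro a z
      simp [Af]
    set α : F → ℝ := fun a => ∑ z ∈ Af a, P z with hα
    have hα0 : ∀ a, 0 ≤ α a := fun a => Finset.sum_nonneg fun z _ => hP0 z
    have hαb : ∀ a, α a ≤ b := by
      intro a
      refine Finset.sum_le_sum_of_subset_of_nonneg (fun z hz => ?_) fun z _ _ => hP0 z
      exact Finset.mem_image.2 ⟨_, (hAf a z).1 hz, by simp⟩
    have hPA : ∑ y ∈ A, ∏ i, m (y i) = ∑ a, m a * α a := by
      have : ∑ y ∈ A, ∏ i, m (y i) = ∑ y, if y ∈ A then ∏ i, m (y i) else 0 := by simp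
      rw [this, sum_cons]
      refine Finset.sum_congr rfl fun a _ => ?_
      rw [hα, Finset.mul_sum, Finset.sum_filter]
      exact Finset.sum_congr rfl fun z _ => by rw [hcons]
    have hull1 : ∀ a z v, DifferenceHull B z v →
        DifferenceHull A (Fin.cons a z : Fin (n + 1) → F) (Fin.cons 1 v) := by
      intro a z v hv w hw
      obtain ⟨y, hy, hle⟩ := hv (fun i => w i.succ) fun i => hw _
      obtain ⟨y', hy', rfl⟩ := Finset.mem_image.1 hy
      refine ⟨y', hy', ?_⟩
      rw [Fin.sum_univ_succ, Fin.sum_univ_succ]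
      simp only [Fin.cons_zero, Fin.cons_succ]
      refine add_le_add (mul_le_mul_of_nonneg_left ?_ (hw 0)) hle
      split_ifs <;> norm_num
    have hull0 : ∀ a z v, DifferenceHull (Af a) z v →
        DifferenceHull A (Fin.cons a z : Fin (n + 1) → F) (Fin.cons 0 v) := by
      intro a z v hv w hw
      obtain ⟨y, hy, hle⟩ := hv (fun i => w i.succ) fun i => hw _
      refine ⟨Fin.cons a y, (hAf a y).1 hy, ?_⟩
      rw [Fin.sum_univ_succ, Fin.sum_univ_succ]
      simpa using hle
    obtain ⟨vB, hvB, hsB⟩ := ih B hBne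
    rcases hb0.eq_or_lt with hb00 | hbpos
    · refine ⟨fun x => Fin.cons 1 (vB (Fin.tail x)), fun x => ?_, ?_⟩
      · have := hull1 (x 0) (Fin.tail x) _ (hvB (Fin.tail x))
        rwa [Fin.cons_self_tail] at this
      · rw [hPA, Finset.sum_eq_zero fun a _ => by
          rw [le_antisymm (hb00 ▸ hαb a) (hα0 a), mul_zero]]
        simp
    -- The bound is affine in `α a`, so it can be averaged over `a` without loss. With `T` the
    -- weight of `A`, what remains is `T / b * (2 - T / b) = 1 - (1 - T / b)² ≤ 1`.
    have hfib : ∀ a, ∃ u : (Fin n → F) → Fin (n + 1) → ℝ,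
        (∀ z, DifferenceHull A (Fin.cons a z : Fin (n + 1) → F) (u z)) ∧
        ∑ z, P z * Real.exp ((∑ i, u z i ^ 2) / 4) ≤ (2 - α a / b) / b := by
      intro a
      -- For a light fibre the projection alone suffices: its extra factor `exp (1 / 4)` is at most
      -- `3 / 2 ≤ 2 - α a / b`.
      rcases lt_or_ge (α a / b) (1 / 2) with hr | hr
      · refine ⟨fun z => Fin.cons 1 (vB z), fun z => hull1 a z _ (hvB z), ?_⟩
        have he : Real.exp (1 / 4) ≤ 3 / 2 := by
          have h := Real.exp_one_lt_d9
          have h4 : Real.exp (1 / 4) ^ 4 = Real.exp 1 := by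
            rw [← Real.exp_nat_mul]; norm_num
          by_contra! hlt
          have := pow_lt_pow_left₀ hlt (by norm_num) (n := 4) (by norm_num)
          rw [h4] at this
          norm_num at this
          linarith
        have hsum : ∑ z, P z * Real.exp ((∑ i, vB z i ^ 2) / 4) ≤ 1 / b := by
          rw [le_div_iff₀ hbpos, mul_comm]; exact hsB
        calc ∑ z, P z * Real.exp ((∑ i, (Fin.cons 1 (vB z) : Fin (n + 1) → ℝ) i ^ 2) / 4)
            = Real.exp (1 / 4) * ∑ z, P z * Real.exp ((∑ i, vB z i ^ 2) / 4) := by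
              rw [Finset.mul_sum]
              refine Finset.sum_congr rfl fun z _ => ?_
              rw [Fin.sum_univ_succ]
              simp only [Fin.cons_zero, Fin.cons_succ, one_pow, add_div, Real.exp_add]
              ring
          _ ≤ 3 / 2 * (1 / b) :=
              mul_le_mul he hsum (Finset.sum_nonneg fun z _ =>
                mul_nonneg (hP0 z) (Real.exp_pos _).le) (by norm_num)
          _ = (3 / 2) / b := by ring
          _ ≤ (2 - α a / b) / b := by gcongr; linarith
      · have hapos : 0 < α a := by
          by_contra! h
          rw [le_antisymm h (hα0 a)] at hr
          norm_num at hr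
        have hne : (Af a).Nonempty := by
          by_contra h
          rw [Finset.not_nonempty_iff_eq_empty] at h
          simp [hα, h] at hapos
        obtain ⟨va, hva, hsa⟩ := ih (Af a) hne
        set r : ℝ := α a / b with hrdef
        have hr1 : r ≤ 1 := (div_le_one hbpos).2 (hαb a)
        have hrpos : 0 < r := by linarith
        set l : ℝ := 2 * r - 1 with hl
        have hl0 : 0 ≤ l := by linarith
        have hl1 : l ≤ 1 := by linarith
        refine ⟨_, fun z => (hull0 a z _ (hva z)).convex (hull1 a z _ (hvB z)) hl0 hl1, ?_⟩
        have hlogr : Real.log (α a) = Real.log r + Real.log b := by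
          rw [hrdef, Real.log_div hapos.ne' hbpos.ne']; ring
        have hexp : Real.exp ((1 - l) ^ 2 / 4 - l * Real.log r) ≤ 2 - r := by
          rw [← Real.exp_log (by linarith : 0 < 2 - r)]
          exact Real.exp_le_exp.2 (convexDistance_exponent_le hr hr1)
        -- Pointwise convexity of `exp` plays the role of Hölder's inequality: scaled by `α a` and
        -- by `b`, the two exponential sums are at most 1 by induction.
        have hpt : ∀ z, Real.exp ((∑ i, (l * (Fin.cons 0 (va z) : Fin (n + 1) → ℝ) i
              + (1 - l) * (Fin.cons 1 (vB z) : Fin (n + 1) → ℝ) i) ^ 2) / 4)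
            ≤ (2 - r) / b * (l * (α a * Real.exp ((∑ i, va z i ^ 2) / 4))
              + (1 - l) * (b * Real.exp ((∑ i, vB z i ^ 2) / 4))) := by
          intro z
          set U := (∑ i, va z i ^ 2) / 4 with hU
          set V := (∑ i, vB z i ^ 2) / 4 with hV
          have hq : (∑ i, (l * (Fin.cons 0 (va z) : Fin (n + 1) → ℝ) i
              + (1 - l) * (Fin.cons 1 (vB z) : Fin (n + 1) → ℝ) i) ^ 2) / 4
              ≤ (1 - l) ^ 2 / 4 + l * U + (1 - l) * V := by
            rw [Fin.sum_univ_succ]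
            simp only [Fin.cons_zero, Fin.cons_succ]
            have : ∑ i, (l * va z i + (1 - l) * vB z i) ^ 2
                ≤ l * ∑ i, va z i ^ 2 + (1 - l) * ∑ i, vB z i ^ 2 := by
              rw [Finset.mul_sum, Finset.mul_sum, ← Finset.sum_add_distrib]
              refine Finset.sum_le_sum fun i _ => ?_
              nlinarith [mul_nonneg (mul_nonneg hl0 (by linarith : 0 ≤ 1 - l))
                (sq_nonneg (va z i - vB z i))]
            rw [hU, hV]
            linarith
          have hconv : Real.exp (l * (Real.log (α a) + U) + (1 - l) * (Real.log b + V))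
              ≤ l * Real.exp (Real.log (α a) + U) + (1 - l) * Real.exp (Real.log b + V) := by
            simpa using convexOn_exp.2 (Set.mem_univ (Real.log (α a) + U))
              (Set.mem_univ (Real.log b + V)) hl0 (by linarith : 0 ≤ 1 - l) (by ring)
          rw [Real.exp_add (Real.log (α a)), Real.exp_add (Real.log b), Real.exp_log hapos,
            Real.exp_log hbpos] at hconv
          calc _ ≤ Real.exp (((1 - l) ^ 2 / 4 - l * Real.log r)
                + (l * (Real.log (α a) + U) + (1 - l) * (Real.log b + V)) - Real.log b) := by
                refine Real.exp_le_exp.2 (hq.trans (le_of_eq ?_))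
                rw [hlogr]; ring
            _ = Real.exp ((1 - l) ^ 2 / 4 - l * Real.log r) / b
                * Real.exp (l * (Real.log (α a) + U) + (1 - l) * (Real.log b + V)) := by
                rw [Real.exp_sub, Real.exp_add, Real.exp_log hbpos]; ring
            _ ≤ _ := by
                have : 0 ≤ (2 - r) / b := div_nonneg (by linarith) hb0
                gcongr
        calc _ ≤ ∑ z, P z * ((2 - r) / b * (l * (α a * Real.exp ((∑ i, va z i ^ 2) / 4))
              + (1 - l) * (b * Real.exp ((∑ i, vB z i ^ 2) / 4)))) :=
              Finset.sum_le_sum fun z _ => mul_le_mul_of_nonneg_left (hpt z) (hP0 z)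
          _ = (2 - r) / b * (l * (α a * ∑ z, P z * Real.exp ((∑ i, va z i ^ 2) / 4))
              + (1 - l) * (b * ∑ z, P z * Real.exp ((∑ i, vB z i ^ 2) / 4))) := by
              simp only [Finset.mul_sum, ← Finset.sum_add_distrib]
              exact Finset.sum_congr rfl fun z _ => by ring
          _ ≤ (2 - r) / b * (l * 1 + (1 - l) * 1) := by
              have : 0 ≤ 2 - r := by linarith
              have : 0 ≤ 1 - l := by linarith
              gcongr
          _ = (2 - r) / b := by ring
    choose u hu hsu using hfib
    refine ⟨fun x => u (x 0) (Fin.tail x), fun x => ?_, ?_⟩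
    · have := hu (x 0) (Fin.tail x)
      rwa [Fin.cons_self_tail] at this
    · rw [hPA, sum_cons]
      simp only [hcons, Fin.cons_zero, Fin.tail_cons]
      set T := ∑ a, m a * α a with hT
      have hT0 : 0 ≤ T := Finset.sum_nonneg fun a _ => mul_nonneg (hm a) (hα0 a)
      have hbound : ∑ a, ∑ z, m a * P z * Real.exp ((∑ i, u a z i ^ 2) / 4)
          ≤ (2 - T / b) / b := by
        calc _ = ∑ a, m a * ∑ z, P z * Real.exp ((∑ i, u a z i ^ 2) / 4) := by
              simp only [Finset.mul_sum, mul_assoc]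
          _ ≤ ∑ a, m a * ((2 - α a / b) / b) :=
              Finset.sum_le_sum fun a _ => mul_le_mul_of_nonneg_left (hsu a) (hm a)
          _ = (2 * (∑ a, m a) - T / b) / b := by
              rw [hT, Finset.mul_sum, Finset.sum_div, ← Finset.sum_sub_distrib, Finset.sum_div]
              exact Finset.sum_congr rfl fun a _ => by ring
          _ = _ := by rw [hs, mul_one]
      calc _ ≤ T * ((2 - T / b) / b) := mul_le_mul_of_nonneg_left hbound hT0
        _ = 1 - (1 - T / b) ^ 2 := by field_simp; ring
        _ ≤ 1 := by nlinarith [sq_nonneg (1 - T / b)]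

/-! ### Error vectors and the distance gain -/

/-- The probability that a symbol of the error vector of the `q`-ary symmetric channel is `a`. -/
noncomputable def errorWeight {F : Type*} [Field F] [Fintype F] [DecidableEq F] (p : ℝ) (a : F) :
    ℝ :=
  if a = 0 then 1 - p else p / ((Fintype.card F : ℝ) - 1)

theorem one_lt_card_real {F : Type*} [Field F] [Fintype F] : (1 : ℝ) < Fintype.card F := by
  exact_mod_cast Fintype.one_lt_card

section Symbol

variable {F : Type*} [Field F] [Fintype F] [DecidableEq F]

theorem sum_ite_eq_zero (a b : ℝ) :
    ∑ x : F, (if x = 0 then a else b) = a + ((Fintype.card F : ℝ) - 1) * b := by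
  rw [← Finset.add_sum_erase _ _ (Finset.mem_univ 0), if_pos rfl,
    Finset.sum_congr rfl (g := fun _ => b) (fun y hy => if_neg (Finset.ne_of_mem_erase hy)),
    Finset.sum_const, Finset.card_erase_of_mem (Finset.mem_univ _), Finset.card_univ,
    nsmul_eq_mul, Nat.cast_sub Fintype.card_pos, Nat.cast_one]

theorem errorWeight_nonneg {p : ℝ} (hp : p ∈ Set.Icc (0 : ℝ) 1) (a : F) : 0 ≤ errorWeight p a := by
  have := one_lt_card_real (F := F)
  unfold errorWeight
  split_ifs
  · linarith [hp.2]
  · exact div_nonneg hp.1 (by linarith)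

theorem sum_errorWeight (p : ℝ) : ∑ a : F, errorWeight p a = 1 := by
  have := one_lt_card_real (F := F)
  unfold errorWeight
  rw [sum_ite_eq_zero, mul_div_cancel₀ _ (by linarith : (Fintype.card F : ℝ) - 1 ≠ 0)]
  ring

theorem qscSymbol_eq {p : ℝ} (hp : p ∈ Set.Icc (0 : ℝ) 1) (x y : F) :
    qscSymbol p hp x y = ENNReal.ofReal (errorWeight p (y - x)) := by
  simp only [qscSymbol, PMF.ofFintype_apply, errorWeight, sub_eq_zero]
  split_ifs <;> rfl

end Symbol

theorem sum_prod_apply {F : Type*} [Fintype F] {n : ℕ} (f : Fin n → F → ℝ) :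
    ∑ x : Fin n → F, ∏ i, f i (x i) = ∏ i, ∑ a, f i a :=
  (Fintype.prod_sum f).symm

section Gain

variable {F : Type*} [Field F] [DecidableEq F] {n : ℕ}

theorem hammingNorm_eq_sum (c : Fin n → F) :
    (hammingNorm c : ℝ) = ∑ i, if c i ≠ 0 then 1 else 0 := by
  simp [hammingNorm, Finset.card_filter]

/-- The contribution of one coordinate to `distanceGain`. -/
noncomputable def symbolGain (b a : F) : ℝ := (if a = 0 then 1 else 0) - (if a = b then 1 else 0)

/-- `d(x, c) - d(x, 0)`, the amount by which `x` is closer to `0` than to `c`. -/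
noncomputable def distanceGain (c x : Fin n → F) : ℝ := ∑ i, symbolGain (c i) (x i)

theorem distanceGain_eq (c x : Fin n → F) :
    distanceGain c x = (hammingNorm (x - c) : ℝ) - hammingNorm x := by
  simp only [distanceGain, symbolGain, hammingNorm, Finset.card_filter, Nat.cast_sum,
    ← Finset.sum_sub_distrib, Pi.sub_apply, sub_ne_zero]
  refine Finset.sum_congr rfl fun i _ => ?_
  split_ifs <;> simp_all

/-- `symbolGain` vanishes identically off the support of `c` and stays in `[-1, 1]` on it. The right
side has the weighted form tested by `DifferenceHull`. -/
theorem distanceGain_sub_le (c x y : Fin n → F) :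
    distanceGain c y - distanceGain c x
      ≤ 2 * ∑ i, (if c i ≠ 0 then 1 else 0) * (if y i = x i then 0 else 1) := by
  rw [distanceGain, distanceGain, ← Finset.sum_sub_distrib, Finset.mul_sum]
  refine Finset.sum_le_sum fun i _ => ?_
  unfold symbolGain
  by_cases h : y i = x i
  · simp [h]
  · by_cases hc : c i = 0
    · simp [hc]
    · simp only [h, if_false, ne_eq, hc, not_false_eq_true, if_true]
      split_ifs <;> norm_num

/-- The number of coordinates in the support of `c` where `x` vanishes. -/
noncomputable def zerosOnSupport (c x : Fin n → F) : ℝ :=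
  ∑ i, if x i = 0 ∧ c i ≠ 0 then 1 else 0

end Gain

section Word

variable {F : Type*} [Field F] [Fintype F] [DecidableEq F] {n : ℕ}

/-- The probability of the error vector `x` under the `q`-ary symmetric channel. -/
noncomputable def wordWeight (p : ℝ) (x : Fin n → F) : ℝ := ∏ i, errorWeight p (x i)

theorem wordWeight_nonneg {p : ℝ} (hp : p ∈ Set.Icc (0 : ℝ) 1) (x : Fin n → F) :
    0 ≤ wordWeight p x :=
  Finset.prod_nonneg fun _ _ => errorWeight_nonneg hp _

theorem sum_wordWeight (p : ℝ) : ∑ x : Fin n → F, wordWeight p x = 1 := by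
  simp only [wordWeight]
  rw [sum_prod_apply (fun _ a => errorWeight p a)]
  simp [sum_errorWeight]

theorem qsc_eq {p : ℝ} (hp : p ∈ Set.Icc (0 : ℝ) 1) (x y : Fin n → F) :
    qsc p hp x y = ENNReal.ofReal (wordWeight p (y - x)) := by
  simp only [qsc, PMF.ofFintype_apply, qscSymbol_eq, wordWeight]
  rw [ENNReal.ofReal_prod_of_nonneg fun i _ => errorWeight_nonneg hp _]
  rfl

/-- A set of error vectors that contains at most one element of each coset of `C` is corrected by
some decoder. -/
theorem admitsCommunication_of_coset_unique (C : Submodule F (Fin n → F)) {p : ℝ}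
    (hp : p ∈ Set.Icc (0 : ℝ) 1) (G : Finset (Fin n → F))
    (hG : ∀ z ∈ G, ∀ c ∈ C, z - c ∈ G → c = 0) {ε : ℝ} (h : 1 - ε ≤ ∑ z ∈ G, wordWeight p z) :
    AdmitsCommunication C p hp ε := by
  classical
  -- The default `0` is used only for words outside every translate `c + G`; they do not enter the
  -- success bound.
  let d : (Fin n → F) → C := fun y => if h : ∃ c : C, y - (c : Fin n → F) ∈ G then h.choose else 0
  have hd : ∀ (c : C) (y : Fin n → F), y - (c : Fin n → F) ∈ G → d y = c := by
    intro c y hy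
    have hex : ∃ c : C, y - (c : Fin n → F) ∈ G := ⟨c, hy⟩
    have hspec := hex.choose_spec
    have hdy : d y = hex.choose := dif_pos hex
    rw [hdy]
    have := hG _ hy (hex.choose - c : C) (hex.choose - c : C).2 (by
      simpa [sub_sub] using hspec)
    exact sub_eq_zero.1 (Subtype.ext this)
  refine ⟨PMF.pure d, fun c => ?_⟩
  rw [successProb, PMF.pure_bind, PMF.map_apply]
  rw [tsum_fintype]
  calc ENNReal.ofReal (1 - ε) ≤ ENNReal.ofReal (∑ z ∈ G, wordWeight p z) :=
        ENNReal.ofReal_le_ofReal h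
    _ = ∑ z ∈ G, ENNReal.ofReal (wordWeight p z) :=
        ENNReal.ofReal_sum_of_nonneg fun z _ => wordWeight_nonneg hp z
    _ = ∑ z : Fin n → F, if z ∈ G then ENNReal.ofReal (wordWeight p z) else 0 := by simp
    _ = ∑ y : Fin n → F, if y - (c : Fin n → F) ∈ G then
          ENNReal.ofReal (wordWeight p (y - (c : Fin n → F))) else 0 :=
        ((Equiv.subRight (c : Fin n → F)).sum_comp _).symm
    _ ≤ _ := by
        refine Finset.sum_le_sum fun y _ => ?_
        by_cases hy : y - (c : Fin n → F) ∈ G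
        · rw [if_pos hy, if_pos (hd c y hy).symm, qsc_eq]
        · rw [if_neg hy]; exact zero_le

/-- If `x` has few zeros on the support of `c`, then some multiple of `c` is much closer to `x`
than `0` is. -/
theorem exists_smul_distanceGain_le (c x : Fin n → F) :
    ∃ a : F, a ≠ 0 ∧ ((Fintype.card F : ℝ) - 1) * distanceGain (a • c) x
      ≤ Fintype.card F * zerosOnSupport c x - hammingNorm c := by
  have hq := one_lt_card_real (F := F)
  set N := zerosOnSupport c x with hN
  have hgain : ∀ a : F, a ≠ 0 → distanceGain (a • c) x
      = N - ∑ i, if c i ≠ 0 ∧ x i = a * c i then 1 else 0 := by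
    intro a ha
    rw [hN, zerosOnSupport, ← Finset.sum_sub_distrib, distanceGain]
    refine Finset.sum_congr rfl fun i _ => ?_
    by_cases hc : c i = 0
    · simp [symbolGain, hc]
    · simp [symbolGain, hc]
  -- A coordinate of the support where `x` is nonzero agrees with exactly one nonzero multiple of
  -- `c`; the existence of a good `a` follows by averaging.
  have hsum : ∑ a ∈ Finset.univ.erase (0 : F), ∑ i, (if c i ≠ 0 ∧ x i = a * c i then (1 : ℝ) else 0)
      = hammingNorm c - N := by
    rw [Finset.sum_comm, hN, zerosOnSupport, hammingNorm_eq_sum, ← Finset.sum_sub_distrib]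
    refine Finset.sum_congr rfl fun i _ => ?_
    by_cases hc : c i = 0
    · simp [hc]
    · have : ∀ a : F, (x i = a * c i) ↔ a = x i / c i := fun a => by
        rw [eq_div_iff hc, eq_comm]
      simp only [this, hc, ne_eq, not_false_eq_true, true_and, and_true]
      rw [Finset.sum_ite_eq']
      by_cases hx : x i = 0 <;> simp [hx, hc]
  by_contra! hcon
  have hlt : ∑ a ∈ Finset.univ.erase (0 : F), ((Fintype.card F : ℝ) * N - hammingNorm c)
      < ∑ a ∈ Finset.univ.erase (0 : F), ((Fintype.card F : ℝ) - 1) * distanceGain (a • c) x :=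
    Finset.sum_lt_sum_of_nonempty ⟨1, by simp⟩ fun a ha => hcon a (Finset.ne_of_mem_erase ha)
  rw [← Finset.mul_sum, Finset.sum_congr rfl fun a ha => hgain a (Finset.ne_of_mem_erase ha),
    Finset.sum_const, Finset.sum_sub_distrib, hsum, Finset.sum_const,
    Finset.card_erase_of_mem (Finset.mem_univ _), Finset.card_univ, nsmul_eq_mul,
    nsmul_eq_mul, Nat.cast_sub Fintype.card_pos, Nat.cast_one] at hlt
  have := lt_of_mul_lt_mul_left hlt (by linarith)
  linarith

/-- Exponential Markov inequality for `distanceGain` under a product weight. -/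
theorem sum_prod_le_prod_sum_exp (k : Fin n → F → ℝ) (hk : ∀ i a, 0 ≤ k i a) (c : Fin n → F)
    (t : ℝ) (S : Finset (Fin n → F)) (hS : ∀ x ∈ S, 0 ≤ t * distanceGain c x) :
    ∑ x ∈ S, ∏ i, k i (x i) ≤ ∏ i, ∑ a, k i a * Real.exp (t * symbolGain (c i) a) := by
  have hk0 : ∀ x : Fin n → F, 0 ≤ ∏ i, k i (x i) := fun x => Finset.prod_nonneg fun i _ => hk _ _
  rw [← sum_prod_apply]
  calc ∑ x ∈ S, ∏ i, k i (x i)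
      ≤ ∑ x ∈ S, (∏ i, k i (x i)) * Real.exp (t * distanceGain c x) :=
        Finset.sum_le_sum fun x hx => le_mul_of_one_le_right (hk0 x)
          (Real.one_le_exp (hS x hx))
    _ ≤ ∑ x, (∏ i, k i (x i)) * Real.exp (t * distanceGain c x) :=
        Finset.sum_le_univ_sum_of_nonneg fun x => mul_nonneg (hk0 x) (Real.exp_pos _).le
    _ = _ := by
        refine Finset.sum_congr rfl fun x _ => ?_
        rw [distanceGain, Finset.mul_sum, Real.exp_sum, Finset.prod_mul_distrib]

/-- The mean weight of the error vector. -/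
theorem sum_wordWeight_mul_hammingNorm (p : ℝ) :
    ∑ x : Fin n → F, wordWeight p x * hammingNorm x = n * p := by
  have hq := one_lt_card_real (F := F)
  have h1 : ∀ j : Fin n, ∑ x : Fin n → F, wordWeight p x * (if x j ≠ 0 then 1 else 0) = p := by
    intro j
    have : ∀ x : Fin n → F, wordWeight p x * (if x j ≠ 0 then 1 else 0)
        = ∏ i, errorWeight p (x i) * (if i = j then (if x i ≠ 0 then 1 else 0) else 1) := by
      intro x
      rw [Finset.prod_mul_distrib, Finset.prod_ite_eq' Finset.univ j, if_pos (Finset.mem_univ _)]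
      rfl
    simp only [this]
    rw [sum_prod_apply (fun i a => errorWeight p a * (if i = j then (if a ≠ 0 then 1 else 0) else 1))]
    rw [Finset.prod_eq_single j]
    · have : ∀ a : F, errorWeight p a * (if j = j then (if a ≠ 0 then 1 else 0) else 1)
          = if a = 0 then 0 else p / ((Fintype.card F : ℝ) - 1) := by
        intro a
        by_cases ha : a = 0 <;> simp [errorWeight, ha]
      rw [Finset.sum_congr rfl fun a _ => this a, sum_ite_eq_zero, mul_div_cancel₀ _ (by linarith : (Fintype.card F : ℝ) - 1 ≠ 0), zero_add]
    · intro i _ hij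
      simp [hij, sum_errorWeight]
    · simp
  simp only [hammingNorm_eq_sum, Finset.mul_sum]
  rw [Finset.sum_comm, Finset.sum_congr rfl fun j _ => h1 j]
  simp

/-- Markov's inequality for the Hamming weight, whose mean is `n * p`. -/
theorem le_sum_wordWeight_of_hammingNorm_le {p r : ℝ} (hp : p ∈ Set.Icc (0 : ℝ) 1) (hr : 0 < r)
    (hn : 0 < n) (S : Finset (Fin n → F)) (hS : ∀ x, (hammingNorm x : ℝ) ≤ r * n → x ∈ S) :
    1 - p / r ≤ ∑ x ∈ S, wordWeight p x := by
  classical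
  have hn' : (0 : ℝ) < n := by exact_mod_cast hn
  have h := sum_wordWeight_mul_hammingNorm (F := F) (n := n) p
  have h1 := sum_wordWeight (F := F) (n := n) p
  rw [← Finset.sum_add_sum_compl S] at h1
  have h2 : r * n * ∑ x ∈ Sᶜ, wordWeight p x ≤ n * p := by
    rw [← h, Finset.mul_sum]
    refine (Finset.sum_le_sum fun x hx => ?_).trans (Finset.sum_le_univ_sum_of_nonneg (s := Sᶜ)
      fun x => mul_nonneg (wordWeight_nonneg hp x) (Nat.cast_nonneg _))
    rw [mul_comm]
    refine mul_le_mul_of_nonneg_left ?_ (wordWeight_nonneg hp x)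
    by_contra! hlt
    exact Finset.mem_compl.1 hx (hS x hlt.le)
  have h3 : ∑ x ∈ Sᶜ, wordWeight p x ≤ p / r := by
    rw [le_div_iff₀ hr]
    nlinarith
  linarith

/-! ### Coset leaders of a list-decodable code -/

theorem wordWeight_eq (p : ℝ) (x : Fin n → F) :
    wordWeight p x = (1 - p) ^ (n - hammingNorm x)
      * (p / ((Fintype.card F : ℝ) - 1)) ^ hammingNorm x := by
  have hz : (Finset.univ.filter fun i => x i = 0).card = n - hammingNorm x := by
    have := Finset.card_filter_add_card_filter_not (s := Finset.univ) (fun i => x i = 0)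
    rw [Finset.card_univ, Fintype.card_fin] at this
    have h2 : (Finset.univ.filter fun i => ¬ x i = 0).card = hammingNorm x := rfl
    omega
  simp only [wordWeight, errorWeight]
  rw [Finset.prod_ite, Finset.prod_const, Finset.prod_const, hz]
  rfl

/-- By `hq` no particular wrong symbol is likelier than the right one, so every further nonzero
coordinate replaces a factor `1 - p` by one that is no larger. -/
theorem wordWeight_anti {p : ℝ} (hp : p ∈ Set.Icc (0 : ℝ) 1)
    (hq : p / ((Fintype.card F : ℝ) - 1) ≤ 1 - p) {x y : Fin n → F}
    (h : hammingNorm x ≤ hammingNorm y) : wordWeight p y ≤ wordWeight p x := by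
  have hq1 := one_lt_card_real (F := F)
  have hy : hammingNorm y ≤ n := by simpa using hammingNorm_le_card_fintype (x := y)
  have h0 : 0 ≤ p / ((Fintype.card F : ℝ) - 1) := div_nonneg hp.1 (by linarith)
  rw [wordWeight_eq, wordWeight_eq,
    show n - hammingNorm x = (n - hammingNorm y) + (hammingNorm y - hammingNorm x) by omega,
    show hammingNorm y = hammingNorm x + (hammingNorm y - hammingNorm x) by omega]
  generalize hammingNorm y - hammingNorm x = k at *
  rw [pow_add, pow_add, show hammingNorm x + k - hammingNorm x = k by omega]
  have := pow_le_pow_left₀ h0 hq k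
  have h3 : 0 ≤ (1 - p) ^ (n - (hammingNorm x + k)) := pow_nonneg (h0.trans hq) _
  have h4 := pow_nonneg h0 (hammingNorm x)
  calc _ = ((1 - p) ^ (n - (hammingNorm x + k)) * (p / ((Fintype.card F : ℝ) - 1)) ^ hammingNorm x)
        * (p / ((Fintype.card F : ℝ) - 1)) ^ k := by ring
    _ ≤ ((1 - p) ^ (n - (hammingNorm x + k)) * (p / ((Fintype.card F : ℝ) - 1)) ^ hammingNorm x)
        * (1 - p) ^ k := by gcongr
    _ = _ := by ring

/-- In a list-decodable code, the minimum-weight vectors of the cosets carry at least a `1 / L`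
fraction of the weight of a Hamming ball. -/
theorem sum_wordWeight_le_mul_of_isListDecodable {C : Submodule F (Fin n → F)} {p r L : ℝ}
    (hp : p ∈ Set.Icc (0 : ℝ) 1) (hq : p / ((Fintype.card F : ℝ) - 1) ≤ 1 - p)
    (hL : IsListDecodable C r L) (S G : Finset (Fin n → F))
    (hS : ∀ x ∈ S, (hammingNorm x : ℝ) ≤ r * n)
    (hG : ∀ x, (∀ c ∈ C, hammingNorm x ≤ hammingNorm (x - c)) → x ∈ G) :
    ∑ x ∈ S, wordWeight p x ≤ L * ∑ x ∈ G, wordWeight p x := by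
  classical
  have hrep : ∀ K : (Fin n → F) ⧸ C, ∃ z : Fin n → F, Submodule.Quotient.mk z = K ∧
      ∀ y : Fin n → F, Submodule.Quotient.mk y = K → hammingNorm z ≤ hammingNorm y := by
    intro K
    obtain ⟨z0, hz0⟩ := Submodule.Quotient.mk_surjective C K
    obtain ⟨z, hz, hmin⟩ := Finset.exists_min_image
      (Finset.univ.filter fun z : Fin n → F => (Submodule.Quotient.mk z : (Fin n → F) ⧸ C) = K)
      hammingNorm ⟨z0, by simpa using hz0⟩
    exact ⟨z, by simpa using hz, fun y hy => hmin y (by simpa using hy)⟩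
  choose g hg hgmin using hrep
  let f : (Fin n → F) → (Fin n → F) := fun x => g (Submodule.Quotient.mk x)
  have hfC : ∀ x, f x - x ∈ C := fun x => (Submodule.Quotient.eq C).1 (hg _)
  have hfG : ∀ x, f x ∈ G := by
    intro x
    refine hG _ fun c hc => hgmin _ _ ?_
    rw [← hg (Submodule.Quotient.mk x), Submodule.Quotient.eq]
    simpa [f] using C.neg_mem hc
  have hL0 : 0 ≤ L := (Nat.cast_nonneg _).trans (hL 0)
  -- The vectors `x ∈ S` with leader `z` inject by `x ↦ z - x` into the codewords within `r * n` of
  -- `z`, so there are at most `L` of them.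
  rw [← Finset.sum_fiberwise_of_maps_to (t := G) (g := f) fun x _ => hfG x, Finset.mul_sum]
  refine Finset.sum_le_sum fun z hz => ?_
  calc ∑ x ∈ S with f x = z, wordWeight p x ≤ ∑ x ∈ S with f x = z, wordWeight p z := by
        refine Finset.sum_le_sum fun x hx => wordWeight_anti hp hq ?_
        rw [← (Finset.mem_filter.1 hx).2]
        exact hgmin _ _ rfl
    _ = ((S.filter fun x => f x = z).card : ℝ) * wordWeight p z := by
        rw [Finset.sum_const, nsmul_eq_mul]
    _ ≤ L * wordWeight p z := by
        refine mul_le_mul_of_nonneg_right (le_trans ?_ (hL z)) (wordWeight_nonneg hp z)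
        rw [Nat.cast_le, ← Finset.card_image_of_injective _ (sub_right_injective (b := z)),
          ← Set.ncard_coe_finset]
        refine Set.ncard_le_ncard (fun c hc => ?_) (Set.toFinite _)
        obtain ⟨x, hx, rfl⟩ := Finset.mem_image.1 (Finset.mem_coe.1 hc)
        obtain ⟨hxS, hxz⟩ := Finset.mem_filter.1 hx
        refine ⟨hxz ▸ hfC x, ?_⟩
        rw [hammingDist_comm, hammingDist_eq_hammingNorm, show -(z - x) + z = x by abel]
        exact hS x hxS

/-! ### Adding noise by raising zeros -/

/-- The kernel that replaces a zero by a uniformly random nonzero symbol with probability `δ`, and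
keeps nonzero symbols. -/
noncomputable def raiseKernel (δ : ℝ) (a b : F) : ℝ :=
  if a = 0 then errorWeight δ b else if a = b then 1 else 0

theorem raiseKernel_nonneg {δ : ℝ} (hδ : δ ∈ Set.Icc (0 : ℝ) 1) (a b : F) :
    0 ≤ raiseKernel δ a b := by
  unfold raiseKernel
  split_ifs
  exacts [errorWeight_nonneg hδ _, zero_le_one, le_rfl]

/-- A zero survives both stages with probability `(1 - p) * (1 - δ)`, and neither stage favours any
nonzero symbol. -/
theorem sum_errorWeight_mul_raiseKernel (p δ : ℝ) (b : F) :
    ∑ a, errorWeight p a * raiseKernel δ a b = errorWeight (p + (1 - p) * δ) b := by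
  rw [← Finset.add_sum_erase _ _ (Finset.mem_univ 0), Finset.sum_congr rfl
    (g := fun a => if a = b then errorWeight p a else 0) (fun a ha => by
      simp [raiseKernel, Finset.ne_of_mem_erase ha]), Finset.sum_ite_eq']
  by_cases hb : b = 0
  · simp [raiseKernel, errorWeight, hb]; ring
  · simp [raiseKernel, errorWeight, hb]; ring

theorem sum_wordWeight_mul_raiseKernel (p δ : ℝ) (y : Fin n → F) :
    ∑ x : Fin n → F, wordWeight p x * ∏ i, raiseKernel δ (x i) (y i)
      = wordWeight (p + (1 - p) * δ) y := by
  simp only [wordWeight, ← Finset.prod_mul_distrib]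
  rw [sum_prod_apply (fun i a => errorWeight p a * raiseKernel δ a (y i))]
  simp [sum_errorWeight_mul_raiseKernel]

theorem sum_raiseKernel {δ : ℝ} (a : F) : ∑ b, raiseKernel δ a b = 1 := by
  unfold raiseKernel
  by_cases ha : a = 0 <;> simp [ha, sum_errorWeight]

theorem sum_prod_raiseKernel {δ : ℝ} (x : Fin n → F) :
    ∑ y : Fin n → F, ∏ i, raiseKernel δ (x i) (y i) = 1 := by
  rw [sum_prod_apply (fun i b => raiseKernel δ (x i) b)]
  simp [sum_raiseKernel]

/-- Only a zero on the support matters: its gain 1 becomes at most 0 with probability `δ`, and `(1 -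
δ) * e + δ ≤ e * (1 - δ / 2)` because `e ≥ 2`. -/
theorem sum_raiseKernel_mul_exp_le {δ : ℝ} (hδ : δ ∈ Set.Icc (0 : ℝ) 1) (a c : F) :
    ∑ b, raiseKernel δ a b * Real.exp (1 * symbolGain c b)
      ≤ Real.exp (symbolGain c a - δ / 2 * (if a = 0 ∧ c ≠ 0 then 1 else 0)) := by
  by_cases ha : a = 0
  · subst ha
    by_cases hc : c = 0
    · simp [symbolGain, raiseKernel, hc, sum_errorWeight]
    · have h1 : ∑ b, raiseKernel δ 0 b * Real.exp (1 * symbolGain c b)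
          ≤ ∑ b : F, if b = 0 then (1 - δ) * Real.exp 1 else δ / ((Fintype.card F : ℝ) - 1) := by
        refine Finset.sum_le_sum fun b _ => ?_
        by_cases hb : b = 0
        · simp [raiseKernel, errorWeight, symbolGain, hb, Ne.symm hc]
        · have h0 := errorWeight_nonneg hδ b
          simp only [raiseKernel, if_true, symbolGain, hb, if_false]
          rw [show errorWeight δ b = δ / ((Fintype.card F : ℝ) - 1) by simp [errorWeight, hb]]
            at h0 ⊢
          refine mul_le_of_le_one_right h0 (Real.exp_le_one_iff.2 ?_)
          split_ifs <;> norm_num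
      have hq := one_lt_card_real (F := F)
      rw [sum_ite_eq_zero, mul_div_cancel₀ _ (by linarith : (Fintype.card F : ℝ) - 1 ≠ 0)] at h1
      refine h1.trans ?_
      simp only [symbolGain, Ne.symm hc, hc, ne_eq, not_false_eq_true, and_self, if_true, if_false,
        sub_zero, mul_one]
      rw [sub_eq_add_neg (1 : ℝ) (δ / 2), Real.exp_add]
      have h2 : 1 - δ / 2 ≤ Real.exp (-(δ / 2)) := by linarith [Real.add_one_le_exp (-(δ / 2))]
      have h3 := Real.exp_one_gt_d9
      nlinarith [hδ.1, Real.exp_pos 1]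
  · simp [raiseKernel, ha]

theorem sum_prod_raiseKernel_le {δ : ℝ} (hδ : δ ∈ Set.Icc (0 : ℝ) 1) (c x : Fin n → F)
    (S : Finset (Fin n → F)) (hS : ∀ y ∈ S, 0 ≤ distanceGain c y) :
    ∑ y ∈ S, ∏ i, raiseKernel δ (x i) (y i)
      ≤ Real.exp (distanceGain c x - δ / 2 * zerosOnSupport c x) := by
  refine (sum_prod_le_prod_sum_exp (fun i b => raiseKernel δ (x i) b)
    (fun i b => raiseKernel_nonneg hδ _ _) c 1 S (by simpa using hS)).trans ?_
  rw [distanceGain, zerosOnSupport, Finset.mul_sum, ← Finset.sum_sub_distrib, Real.exp_sum]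
  exact Finset.prod_le_prod (fun i _ => Finset.sum_nonneg fun b _ =>
    mul_nonneg (raiseKernel_nonneg hδ _ _) (Real.exp_pos _).le)
    fun i _ => sum_raiseKernel_mul_exp_le hδ _ _

end Word

theorem le_hammingNorm_of_le_minDist {F : Type*} [Field F] [DecidableEq F] {n : ℕ}
    {C : Submodule F (Fin n → F)} {d : ℝ}
    (h : ENNReal.ofReal d ≤ (minDist C : ENNReal)) {c : Fin n → F} (hc : c ∈ C) (hc0 : c ≠ 0) :
    d ≤ hammingNorm c := by
  have h1 : minDist C ≤ (hammingNorm c : ℕ∞) := by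
    refine (iInf₂_le c hc).trans ((iInf₂_le 0 C.zero_mem).trans ((iInf_le _ hc0).trans ?_))
    rw [hammingDist_zero_right]
  have h2 := h.trans (ENat.toENNReal_le.2 h1)
  rw [ENat.toENNReal_coe, ← ENNReal.ofReal_natCast, ENNReal.ofReal_le_ofReal_iff (by simp)] at h2
  exact h2

/-! ### Creating a margin and amplifying it -/

section Code

variable {F : Type*} [Field F] [Fintype F] [DecidableEq F] {n : ℕ}

/-- A set of vectors that do not prefer any codeword to `0` is, over a noisier channel, hardly more
likely than the vectors that prefer `0` to every other codeword by a margin are over the given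
channel. -/
theorem sum_wordWeight_le_margin {C : Submodule F (Fin n → F)} {p δ s τ : ℝ}
    (hp : p ∈ Set.Icc (0 : ℝ) 1) (hδ : δ ∈ Set.Icc (0 : ℝ) 1) (hs : 0 ≤ s)
    (hC : ∀ c ∈ C, c ≠ 0 → 8 * Fintype.card F * s ≤ δ * √(hammingNorm c))
    (hτ : ∀ c ∈ C, c ≠ 0 → τ ≤ s * √(hammingNorm c))
    (S A : Finset (Fin n → F)) (hS : ∀ y ∈ S, ∀ c ∈ C, 0 ≤ distanceGain c y)
    (hA : ∀ x, (∀ c ∈ C, c ≠ 0 → s * √(hammingNorm c) < distanceGain c x) → x ∈ A) :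
    ∑ y ∈ S, wordWeight (p + (1 - p) * δ) y ≤ ∑ x ∈ A, wordWeight p x + Real.exp (-τ) := by
  have hq := one_lt_card_real (F := F)
  have hbad : ∀ x, x ∉ A → ∑ y ∈ S, ∏ i, raiseKernel δ (x i) (y i) ≤ Real.exp (-τ) := by
    intro x hx
    have : ¬ ∀ c ∈ C, c ≠ 0 → s * √(hammingNorm c) < distanceGain c x := fun h => hx (hA x h)
    push Not at this
    obtain ⟨c, hcC, hc0, hle⟩ := this
    have hR := hC c hcC hc0
    have hτc := hτ c hcC hc0
    set q : ℝ := (Fintype.card F : ℝ) with hqdef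
    set R : ℝ := √(hammingNorm c) with hRdef
    have hR0 : 0 ≤ R := Real.sqrt_nonneg _
    have hw : (hammingNorm c : ℝ) = R * R := (Real.mul_self_sqrt (Nat.cast_nonneg _)).symm
    have hN0 : ∀ c', 0 ≤ zerosOnSupport c' x := fun c' =>
      Finset.sum_nonneg fun i _ => by split_ifs <;> norm_num
    have hRR : 8 * q * s * R ≤ δ * R * R := mul_le_mul_of_nonneg_right hR hR0
    -- With many zeros on the support of `c`, raising lowers the exponent by at least `2 * s * R`,
    -- twice the gain that `x` may have. With few, some multiple of `c` beats `0` by `s * R` before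
    -- any raising.
    rcases le_or_gt (R * R / 2) (q * zerosOnSupport c x) with h | h
    · refine (sum_prod_raiseKernel_le hδ c x S fun y hy => hS y hy c hcC).trans
        (Real.exp_le_exp.2 ?_)
      have h1 : δ * (R * R / 2) ≤ δ * (q * zerosOnSupport c x) := mul_le_mul_of_nonneg_left h hδ.1
      have h2 : q * (4 * s * R) ≤ q * (δ * zerosOnSupport c x) := by linarith
      have h3 := le_of_mul_le_mul_left h2 (by linarith)
      linarith
    · obtain ⟨a, ha, hgain⟩ := exists_smul_distanceGain_le c x
      rw [hw] at hgain
      refine (sum_prod_raiseKernel_le hδ (a • c) x S fun y hy => hS y hy _ (C.smul_mem a hcC)).trans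
        (Real.exp_le_exp.2 ?_)
      have h1 : 0 ≤ δ / 2 * zerosOnSupport (a • c) x :=
        mul_nonneg (by linarith [hδ.1]) (hN0 _)
      have h2 : δ * R * R ≤ R * R := by
        rw [mul_assoc]; exact mul_le_of_le_one_left (mul_nonneg hR0 hR0) hδ.2
      have h3 : 0 ≤ s * R := mul_nonneg hs hR0
      have h4 : (q - 1) * distanceGain (a • c) x ≤ (q - 1) * (-(s * R)) := by
        nlinarith [mul_nonneg (by linarith : 0 ≤ q) h3]
      have h5 := le_of_mul_le_mul_left h4 (by linarith)
      linarith
  have hK0 : ∀ x y : Fin n → F, 0 ≤ ∏ i, raiseKernel δ (x i) (y i) := fun x y =>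
    Finset.prod_nonneg fun i _ => raiseKernel_nonneg hδ _ _
  calc ∑ y ∈ S, wordWeight (p + (1 - p) * δ) y
      = ∑ x, wordWeight p x * ∑ y ∈ S, ∏ i, raiseKernel δ (x i) (y i) := by
        simp only [← sum_wordWeight_mul_raiseKernel, Finset.mul_sum]
        exact Finset.sum_comm
    _ ≤ ∑ x, ((if x ∈ A then wordWeight p x else 0) + wordWeight p x * Real.exp (-τ)) := by
        refine Finset.sum_le_sum fun x _ => ?_
        have h0 := wordWeight_nonneg hp x
        by_cases hx : x ∈ A
        · rw [if_pos hx]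
          have h1 : ∑ y ∈ S, ∏ i, raiseKernel δ (x i) (y i) ≤ 1 :=
            (Finset.sum_le_univ_sum_of_nonneg (hK0 x)).trans_eq (sum_prod_raiseKernel x)
          have := mul_le_mul_of_nonneg_left h1 h0
          have := mul_nonneg h0 (Real.exp_pos (-τ)).le
          linarith
        · rw [if_neg hx, zero_add]
          exact mul_le_mul_of_nonneg_left (hbad x hx) h0
    _ = _ := by
        rw [Finset.sum_add_distrib, ← Finset.sum_mul, sum_wordWeight, one_mul]
        simp

/-- By concentration, if vectors that prefer `0` to all other codewords by a margin are not too
rare, then almost all vectors prefer `0`. -/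
theorem sum_margin_mul_le {C : Submodule F (Fin n → F)} {p t : ℝ} (hp : p ∈ Set.Icc (0 : ℝ) 1)
    (ht : 0 ≤ t) (A G : Finset (Fin n → F))
    (hA : ∀ y ∈ A, ∀ c ∈ C, c ≠ 0 → 2 * t * √(hammingNorm c) < distanceGain c y)
    (hG : ∀ x, (∀ c ∈ C, c ≠ 0 → 0 < distanceGain c x) → x ∈ G) :
    (∑ x ∈ A, wordWeight p x) * (1 - ∑ x ∈ G, wordWeight p x) ≤ Real.exp (-(t ^ 2 / 4)) := by
  rcases A.eq_empty_or_nonempty with rfl | hne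
  · simpa using (Real.exp_pos _).le
  obtain ⟨v, hv, hsum⟩ := exists_differenceHull (errorWeight p) (errorWeight_nonneg hp)
    (sum_errorWeight (F := F) p) n A hne
  have hfar : ∀ x, x ∉ G → t ^ 2 ≤ ∑ i, v x i ^ 2 := by
    intro x hx
    by_contra! hlt
    refine hx (hG x fun c hc hc0 => ?_)
    -- Testing the hull on the support of `c` gives, by Cauchy–Schwarz, a `y ∈ A` that differs from
    -- `x` in at most `t * √|c|` places there. The gain changes by at most twice that, less than the
    -- margin of `y`.
    obtain ⟨y, hy, hle⟩ := hv x (fun i => if c i ≠ 0 then 1 else 0) fun i => by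
      split_ifs <;> norm_num
    have hcs := Finset.sum_mul_sq_le_sq_mul_sq Finset.univ
      (fun i => if c i ≠ 0 then (1 : ℝ) else 0) (v x)
    have h1 : ∑ i, (if c i ≠ 0 then (1 : ℝ) else 0) ^ 2 = hammingNorm c := by
      rw [hammingNorm_eq_sum]
      exact Finset.sum_congr rfl fun i _ => by split_ifs <;> norm_num
    rw [h1] at hcs
    have h2 : ∑ i, (if c i ≠ 0 then (1 : ℝ) else 0) * v x i ≤ t * √(hammingNorm c) := by
      refine le_of_sq_le_sq ?_ (mul_nonneg ht (Real.sqrt_nonneg _))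
      rw [mul_pow, Real.sq_sqrt (Nat.cast_nonneg _), mul_comm]
      exact hcs.trans (mul_le_mul_of_nonneg_left hlt.le (Nat.cast_nonneg _))
    have h3 := distanceGain_sub_le c x y
    have h4 := hA y hy c hc hc0
    linarith
  have hP0 : 0 ≤ ∑ x ∈ A, wordWeight p x := Finset.sum_nonneg fun x _ => wordWeight_nonneg hp x
  have htot := sum_wordWeight (F := F) (n := n) p
  rw [← Finset.sum_add_sum_compl G] at htot
  have hmark : Real.exp (t ^ 2 / 4) * ∑ x ∈ Gᶜ, wordWeight p x
      ≤ ∑ x, wordWeight p x * Real.exp ((∑ i, v x i ^ 2) / 4) := by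
    rw [Finset.mul_sum]
    refine (Finset.sum_le_sum fun x hx => ?_).trans (Finset.sum_le_univ_sum_of_nonneg (s := Gᶜ)
      fun x => mul_nonneg (wordWeight_nonneg hp x) (Real.exp_pos _).le)
    rw [mul_comm]
    refine mul_le_mul_of_nonneg_left (Real.exp_le_exp.2 ?_) (wordWeight_nonneg hp x)
    linarith [hfar x (Finset.mem_compl.1 hx)]
  rw [Real.exp_neg, ← one_div, le_div_iff₀ (Real.exp_pos _)]
  calc _ = (∑ x ∈ A, wordWeight p x) * (Real.exp (t ^ 2 / 4) * ∑ x ∈ Gᶜ, wordWeight p x) := by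
        rw [← htot]; ring
    _ ≤ (∑ x ∈ A, wordWeight p x) * ∑ x, wordWeight p x * Real.exp ((∑ i, v x i ^ 2) / 4) :=
        mul_le_mul_of_nonneg_left hmark hP0
    _ ≤ 1 := hsum

/-! ### Channels that favour wrong symbols -/

/-- If errors are so frequent that each wrong symbol is more likely than the right one, then an
error vector is unlikely to prefer `0` to a given codeword. -/
theorem sum_wordWeight_le_exp_of_gap {p g : ℝ} (hp : p ∈ Set.Icc (0 : ℝ) 1) (hg0 : 0 < g)
    (hg : 1 - p + g ≤ p / ((Fintype.card F : ℝ) - 1)) (c : Fin n → F) (S : Finset (Fin n → F))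
    (hS : ∀ x ∈ S, 0 ≤ distanceGain c x) :
    ∑ x ∈ S, wordWeight p x ≤ Real.exp (-(g ^ 2 / 8 * hammingNorm c)) := by
  have hb1 : p / ((Fintype.card F : ℝ) - 1) ≤ 1 := by
    have h := Finset.single_le_sum (f := fun a : F => errorWeight p a)
      (fun a _ => errorWeight_nonneg hp a) (Finset.mem_univ 1)
    rw [sum_errorWeight] at h
    simpa [errorWeight] using h
  set b : ℝ := p / ((Fintype.card F : ℝ) - 1) with hb
  have hg1 : g ≤ 1 := by linarith [hp.2]
  have hu : 0 < 1 + g / 2 := by linarith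
  have hlog : 0 ≤ Real.log (1 + g / 2) := Real.log_nonneg (by linarith)
  -- Tilting by `u = 1 + g / 2` gives each support coordinate the factor `1 + (u - 1) * (1 - p - b /
  -- u)`, which is at most `1 - g² / 8`.
  refine (sum_prod_le_prod_sum_exp (fun _ => errorWeight p) (fun _ a => errorWeight_nonneg hp a) c
    (Real.log (1 + g / 2)) S fun x hx => mul_nonneg hlog (hS x hx)).trans ?_
  rw [hammingNorm_eq_sum, Finset.mul_sum, ← Finset.sum_neg_distrib, Real.exp_sum]
  refine Finset.prod_le_prod (fun i _ => Finset.sum_nonneg fun a _ =>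
    mul_nonneg (errorWeight_nonneg hp a) (Real.exp_pos _).le) fun i _ => ?_
  by_cases hc : c i = 0
  · simp [hc, symbolGain, sum_errorWeight]
  · have he : ∀ a : F, errorWeight p a * Real.exp (Real.log (1 + g / 2) * symbolGain (c i) a)
        = errorWeight p a + (if a = 0 then errorWeight p a * (g / 2) else 0)
          + (if a = c i then errorWeight p a * ((1 + g / 2)⁻¹ - 1) else 0) := by
      intro a
      by_cases ha : a = 0
      · have : a ≠ c i := fun h => hc (h ▸ ha)
        simp only [symbolGain, ha, if_true, Ne.symm hc, if_false, sub_zero, mul_one,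
          Real.exp_log hu]
        ring
      · by_cases hac : a = c i
        · simp only [symbolGain, ← hac, ha, if_true, if_false, zero_sub, mul_neg, mul_one,
            Real.exp_neg, Real.exp_log hu]
          ring
        · simp [symbolGain, ha, hac]
    rw [Finset.sum_congr rfl fun a _ => he a, Finset.sum_add_distrib, Finset.sum_add_distrib,
      Finset.sum_ite_eq', Finset.sum_ite_eq', if_pos (Finset.mem_univ _),
      if_pos (Finset.mem_univ _), sum_errorWeight]
    simp only [errorWeight, if_true, hc, if_false, ne_eq, not_false_eq_true, mul_one, ← hb]
    refine le_trans ?_ (Real.add_one_le_exp _)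
    have hinv : (1 + g / 2)⁻¹ - 1 = -((g / 2) / (1 + g / 2)) := by field_simp; ring
    have h1 : (1 - p + g) * ((g / 2) / (1 + g / 2)) ≤ b * ((g / 2) / (1 + g / 2)) :=
      mul_le_mul_of_nonneg_right hg (by positivity)
    have h2 : (1 - p) * (g / 2) - (1 - p + g) * ((g / 2) / (1 + g / 2)) ≤ -(g ^ 2 / 8) := by
      rw [← sub_nonneg]
      have : -(g ^ 2 / 8) - ((1 - p) * (g / 2) - (1 - p + g) * ((g / 2) / (1 + g / 2)))
          = g ^ 2 / 4 * ((1 / 2 - g / 4) + p) / (1 + g / 2) := by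
        field_simp; ring
      rw [this]
      have := hp.1
      have : 0 ≤ 1 / 2 - g / 4 := by linarith
      positivity
    rw [hinv]
    linarith

/-- A Hamming ball of radius greater than the mean weight of a uniformly random vector contains a
constant fraction of all vectors, and hence some ball contains such a fraction of the code. -/
theorem card_mul_le_of_isListDecodable {C : Submodule F (Fin n → F)} {r L : ℝ} (hr : 0 < r)
    (hn : 0 < n) (hL : IsListDecodable C r L) :
    (Nat.card C : ℝ) * (1 - (1 - 1 / (Fintype.card F : ℝ)) / r) ≤ L := by
  classical
  have hq := one_lt_card_real (F := F)
  set q : ℝ := (Fintype.card F : ℝ) with hqdef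
  have hp : 1 - 1 / q ∈ Set.Icc (0 : ℝ) 1 := by
    constructor
    · rw [sub_nonneg, div_le_one (by linarith)]; exact hq.le
    · rw [sub_le_self_iff]; positivity
  -- At noise level `1 - 1 / q` the error vector is uniform, so the weight of `S` is its density in
  -- the whole space.
  have hconst : ∀ x : Fin n → F, wordWeight (1 - 1 / q) x = (1 / q) ^ n := by
    intro x
    have : ∀ a : F, errorWeight (1 - 1 / q) a = 1 / q := by
      intro a
      have h1 : q - 1 ≠ 0 := by linarith
      have h2 : q ≠ 0 := by linarith
      unfold errorWeight
      rw [← hqdef]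
      split_ifs
      · ring
      · field_simp
    simp only [wordWeight, this, Finset.prod_const, Finset.card_univ, Fintype.card_fin]
  set S : Finset (Fin n → F) := Finset.univ.filter fun x => (hammingNorm x : ℝ) ≤ r * n with hS
  have hV := le_sum_wordWeight_of_hammingNorm_le hp hr hn S fun x hx => by simpa [hS] using hx
  have hball : ∀ w : Fin n → F, ∑ c : C, (if w - (c : Fin n → F) ∈ S then (1 : ℝ) else 0) ≤ L := by
    intro w
    refine le_trans ?_ (hL w)
    rw [← Finset.sum_filter, Finset.sum_const, nsmul_eq_mul, mul_one, Nat.cast_le,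
      ← Finset.card_image_of_injective _ (Subtype.val_injective (p := (· ∈ C))),
      ← Set.ncard_coe_finset]
    refine Set.ncard_le_ncard (fun c hc => ?_) (Set.toFinite _)
    obtain ⟨c, hc, rfl⟩ := Finset.mem_image.1 (Finset.mem_coe.1 hc)
    refine ⟨c.2, ?_⟩
    rw [hammingDist_comm, hammingDist_eq_hammingNorm, neg_add_eq_sub]
    simpa [hS] using hc
  calc (Nat.card C : ℝ) * (1 - (1 - 1 / q) / r)
      = ∑ c : C, (1 - (1 - 1 / q) / r) := by
        rw [Finset.sum_const, nsmul_eq_mul, Finset.card_univ, Nat.card_eq_fintype_card]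
    _ ≤ ∑ c : C, ∑ w : Fin n → F, (1 / q) ^ n * if w - (c : Fin n → F) ∈ S then (1 : ℝ) else 0 := by
        refine Finset.sum_le_sum fun c _ => hV.trans_eq ?_
        refine Eq.trans ?_ (Equiv.sum_comp (Equiv.subRight (c : Fin n → F))
          (fun x => (1 / q) ^ n * if x ∈ S then (1 : ℝ) else 0)).symm
        simp only [hconst, mul_ite, mul_one, mul_zero, Finset.sum_ite_mem, Finset.univ_inter]
    _ = ∑ w : Fin n → F, (1 / q) ^ n * ∑ c : C, if w - (c : Fin n → F) ∈ S then (1 : ℝ) else 0 := by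
        rw [Finset.sum_comm]
        simp only [Finset.mul_sum]
    _ ≤ ∑ w : Fin n → F, wordWeight (1 - 1 / q) w * L := by
        refine Finset.sum_le_sum fun w _ => ?_
        rw [hconst]
        exact mul_le_mul_of_nonneg_left (hball w) (by positivity)
    _ = L := by rw [← Finset.sum_mul, sum_wordWeight, one_mul]

theorem one_le_of_isListDecodable {C : Submodule F (Fin n → F)} {r L : ℝ} (hr : 0 ≤ r)
    (hL : IsListDecodable C r L) : 1 ≤ L := by
  refine le_trans ?_ (hL 0)
  rw [Nat.one_le_cast, Nat.one_le_iff_ne_zero, ← Nat.pos_iff_ne_zero,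
    Set.ncard_pos (Set.toFinite _)]
  exact ⟨0, C.zero_mem, by simpa using mul_nonneg hr (Nat.cast_nonneg n)⟩

end Code

/-! ### Assembling the two regimes -/

/-- The arithmetic that combines the two steps of the argument: a margin event of probability at
least `1 / (2 * N)`, amplified by concentration. -/
theorem one_sub_le_of_margin {n N l PM PA PG : ℝ} (hn : 0 < n) (hnN : n ≤ N) (hN2 : 2 ≤ N)
    (hl : Real.exp l = N) (hM : 1 ≤ N * PM) (hA : PM ≤ PA + Real.exp (-(2 * l)))
    (hG : PA * (1 - PG) ≤ Real.exp (-(4 * l))) : 1 - 1 / n ≤ PG := by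
  have hN0 : 0 < N := by linarith
  have e2 : Real.exp (-(2 * l)) = 1 / N ^ 2 := by
    rw [Real.exp_neg, ← hl, ← Real.exp_nat_mul, one_div]; norm_num
  have e4 : Real.exp (-(4 * l)) = 1 / N ^ 4 := by
    rw [Real.exp_neg, ← hl, ← Real.exp_nat_mul, one_div]; norm_num
  have hA1 : 1 / 2 ≤ N * PA := by
    have h1 : N * PM ≤ N * (PA + 1 / N ^ 2) := mul_le_mul_of_nonneg_left (e2 ▸ hA) hN0.le
    have h2 : N * (1 / N ^ 2) = 1 / N := by field_simp
    have h3 : 1 / N ≤ 1 / 2 := by gcongr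
    linarith
  rcases le_or_gt 1 PG with h | h
  · have : 0 ≤ 1 / n := by positivity
    linarith
  · have h1 : 1 / 2 * (1 - PG) ≤ N * (1 / N ^ 4) := by
      calc 1 / 2 * (1 - PG) ≤ N * PA * (1 - PG) :=
            mul_le_mul_of_nonneg_right hA1 (by linarith)
        _ = N * (PA * (1 - PG)) := by ring
        _ ≤ _ := mul_le_mul_of_nonneg_left (e4 ▸ hG) hN0.le
    have h2 : N * (1 / N ^ 4) = 1 / N * (1 / N ^ 2) := by field_simp
    have h3 : 1 / N ^ 2 ≤ 1 / 2 := by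
      gcongr
      nlinarith
    have h4 : 1 / N * (1 / N ^ 2) ≤ 1 / n * (1 / 2) := by gcongr
    linarith

section Regimes

variable {F : Type*} [Field F] [Fintype F] [DecidableEq F] {n : ℕ}

/-- The case in which the right symbol stays the most likely one. -/
theorem admitsCommunication_of_le {C : Submodule F (Fin n → F)} {p L : ℝ}
    (hp : p ∈ Set.Ioo (0 : ℝ) 1) (hpq : p ≤ 1 - 1 / (Fintype.card F : ℝ))
    (hn : 121 ≤ Real.log n) (hp' : p - 7 / Real.log n ∈ Set.Icc (0 : ℝ) 1)
    (hL : IsListDecodable C p L)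
    (hd : ∀ c ∈ C, c ≠ 0 → (Fintype.card F : ℝ) ^ 3 / (1 - p) ^ 2 * Real.log (n * L) ^ 4
      ≤ hammingNorm c) :
    AdmitsCommunication C (p - 7 / Real.log n) hp' (1 / n) := by
  classical
  have hq := one_lt_card_real (F := F)
  have hL1 := one_le_of_isListDecodable hp.1.le hL
  have hn0 : 0 < n := by
    rcases Nat.eq_zero_or_pos n with h | h
    · rw [h] at hn; norm_num at hn
    · exact h
  have hn0' : (0 : ℝ) < n := by exact_mod_cast hn0
  have hlogn : Real.log n ≤ n := (Real.log_le_sub_one_of_pos hn0').trans (by linarith)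
  set q : ℝ := (Fintype.card F : ℝ) with hqdef
  set lam := Real.log n with hlam
  set N : ℝ := n * L with hN
  have hnN : (n : ℝ) ≤ N := le_mul_of_one_le_right hn0'.le hL1
  have hN0 : 0 < N := hn0'.trans_le hnN
  set l := Real.log N with hl
  have hlaml : lam ≤ l := Real.log_le_log hn0' hnN
  have hexpl : Real.exp l = N := Real.exp_log hN0
  have hlam0 : 0 < lam := by linarith
  set p' := p - 7 / lam with hp'def
  have h7 : 0 < 7 / lam := by positivity
  have hp'1 : 0 < 1 - p' := by linarith [hp.2]
  -- Of the gap `7 / lam`, raising uses `6 / lam` to lead from `p'` to `p - 1 / lam`; the remaining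
  -- `1 / lam` is the room for Markov's inequality in the ball of radius `p * n`.
  set δ := 6 / lam / (1 - p') with hδdef
  have hδ : δ ∈ Set.Icc (0 : ℝ) 1 := by
    refine ⟨by positivity, (div_le_one hp'1).2 ?_⟩
    have : 6 / lam ≤ 7 / lam := by gcongr; norm_num
    linarith [hp.2]
  have hδge : 6 / l ≤ δ := by
    calc 6 / l ≤ 6 / lam := by gcongr
      _ ≤ δ := by
        rw [hδdef, le_div_iff₀ hp'1]
        exact mul_le_of_le_one_right (by positivity) (by linarith [hp'.1])
  have hp1 : p' + (1 - p') * δ = p - 1 / lam := by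
    rw [hδdef, mul_div_cancel₀ _ hp'1.ne', hp'def]; ring
  have hlam1 : 1 / lam ≤ 7 / lam := by gcongr; norm_num
  have hp1mem : p - 1 / lam ∈ Set.Icc (0 : ℝ) 1 :=
    ⟨by linarith [hp'.1], by have : 0 < 1 / lam := by positivity
                             linarith [hp.2]⟩
  have hp1q : (p - 1 / lam) / (q - 1) ≤ 1 - (p - 1 / lam) := by
    rw [div_le_iff₀ (by linarith)]
    have h1 : p * q ≤ q - 1 := by
      have := mul_le_mul_of_nonneg_right hpq (by linarith : 0 ≤ q)
      rwa [sub_mul, one_mul, one_div, inv_mul_cancel₀ (by linarith)] at this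
    have h2 : 0 < 1 / lam * q := by positivity
    linarith
  set r := √l with hr
  have hrr : r * r = l := Real.mul_self_sqrt (by linarith)
  -- The threshold 121 serves `64 ≤ 6 * r`, needed for the raising condition.
  have hr11 : 11 ≤ r := Real.le_sqrt_of_sq_le (by linarith)
  have hdist : ∀ c ∈ C, c ≠ 0 → q * l ^ 2 ≤ √(hammingNorm c) := by
    intro c hc hc0
    refine Real.le_sqrt_of_sq_le (le_trans ?_ (hd c hc hc0))
    have h1 : q ^ 2 ≤ q ^ 3 := pow_le_pow_right₀ hq.le (by norm_num)
    have h2 : q ^ 3 ≤ q ^ 3 / (1 - p) ^ 2 := by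
      have h1p : 0 < 1 - p := by linarith [hp.2]
      rw [le_div_iff₀ (by positivity)]
      exact mul_le_of_le_one_right (by positivity)
        (pow_le_one₀ h1p.le (by linarith [hp.1]))
    calc (q * l ^ 2) ^ 2 = q ^ 2 * l ^ 4 := by ring
      _ ≤ _ := by gcongr; exact h1.trans h2
  set S : Finset (Fin n → F) := Finset.univ.filter fun x => (hammingNorm x : ℝ) ≤ p * n with hS
  set M : Finset (Fin n → F) := Finset.univ.filter fun x => ∀ c ∈ C, 0 ≤ distanceGain c x with hM
  -- The margin corresponds to `t = 4 * r`, for which the concentration bound `exp (-t² / 4)` is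
  -- `N⁻⁴`.
  set A : Finset (Fin n → F) := Finset.univ.filter fun x =>
    ∀ c ∈ C, c ≠ 0 → 2 * (4 * r) * √(hammingNorm c) < distanceGain c x with hA
  set G : Finset (Fin n → F) := Finset.univ.filter fun x =>
    ∀ c ∈ C, c ≠ 0 → 0 < distanceGain c x with hG
  have hSw : 1 - (p - 1 / lam) / p ≤ ∑ x ∈ S, wordWeight (p - 1 / lam) x :=
    le_sum_wordWeight_of_hammingNorm_le hp1mem hp.1 hn0 S fun x hx => by simpa [hS] using hx
  have hMw : ∑ x ∈ S, wordWeight (p - 1 / lam) x ≤ L * ∑ x ∈ M, wordWeight (p - 1 / lam) x := by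
    refine sum_wordWeight_le_mul_of_isListDecodable hp1mem hp1q hL S M
      (fun x hx => by simpa [hS] using hx) fun x hx => ?_
    simp only [hM, Finset.mem_filter, Finset.mem_univ, true_and, distanceGain_eq, sub_nonneg,
      Nat.cast_le]
    exact hx
  have hAw : ∑ x ∈ M, wordWeight (p - 1 / lam) x
      ≤ ∑ x ∈ A, wordWeight p' x + Real.exp (-(2 * l)) := by
    rw [← hp1]
    refine sum_wordWeight_le_margin (C := C) (s := 2 * (4 * r)) hp' hδ (by linarith) ?_ ?_ M A
      (fun x hx => by simpa [hM] using hx) fun x hx => by simpa [hA] using hx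
    · intro c hc hc0
      calc 8 * q * (2 * (4 * r)) = q * r * 64 := by ring
        _ ≤ q * r * (6 * r) := by gcongr; linarith
        _ = 6 * q * l := by rw [← hrr]; ring
        _ = 6 / l * (q * l ^ 2) := by
          have : l ≠ 0 := by linarith
          field_simp
        _ ≤ δ * √(hammingNorm c) := mul_le_mul hδge (hdist c hc hc0) (by positivity) hδ.1
    · intro c hc hc0
      have h1 : l ≤ q * l ^ 2 := by
        have : 1 ≤ q * l := one_le_mul_of_one_le_of_one_le hq.le (by linarith)
        nlinarith
      have h2 := h1.trans (hdist c hc hc0)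
      nlinarith
  have hGw := sum_margin_mul_le (C := C) (t := 4 * r) hp' (by linarith) A G
    (fun x hx => by simpa [hA] using hx) fun x hx => by simpa [hG] using hx
  refine admitsCommunication_of_coset_unique C hp' G (fun z hz c hc hzc => ?_) ?_
  · by_contra hc0
    simp only [hG, Finset.mem_filter, Finset.mem_univ, true_and, distanceGain_eq] at hz hzc
    have h1 := hz c hc hc0
    have h2 := hzc (-c) (C.neg_mem hc) (neg_ne_zero.2 hc0)
    rw [sub_neg_eq_add, sub_add_cancel] at h2
    linarith
  · rw [show (4 * r) ^ 2 / 4 = 4 * l by rw [← hrr]; ring] at hGw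
    have hS1 : 1 / lam ≤ ∑ x ∈ S, wordWeight (p - 1 / lam) x := by
      refine le_trans ?_ hSw
      have : 1 - (p - 1 / lam) / p = 1 / lam / p := by
        have := hp.1.ne'
        field_simp; ring
      rw [this, le_div_iff₀ hp.1]
      exact mul_le_of_le_one_right (by positivity) hp.2.le
    set PM := ∑ x ∈ M, wordWeight (p - 1 / lam) x
    set PA := ∑ x ∈ A, wordWeight p' x
    set PG := ∑ x ∈ G, wordWeight p' x
    have hM1 : 1 ≤ N * PM := by
      have h1 : 1 / lam ≤ L * PM := hS1.trans hMw
      have h2 : (n : ℝ) * (1 / lam) ≤ n * (L * PM) := mul_le_mul_of_nonneg_left h1 hn0'.le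
      have h3 : 1 ≤ (n : ℝ) * (1 / lam) := by
        rw [mul_one_div, le_div_iff₀ hlam0, one_mul]; exact hlogn
      rw [hN, mul_assoc]; linarith
    exact one_sub_le_of_margin hn0' hnN (by linarith) hexpl hM1 hAw hGw

/-- The union bound over the nonzero codewords. -/
theorem sum_compl_le_card_mul {C : Submodule F (Fin n → F)} {p e : ℝ}
    (hp : p ∈ Set.Icc (0 : ℝ) 1) (he : 0 ≤ e) (G : Finset (Fin n → F))
    (hG : ∀ x, (∀ c ∈ C, c ≠ 0 → distanceGain c x < 0) → x ∈ G)
    (h : ∀ c ∈ C, c ≠ 0 → ∀ S : Finset (Fin n → F), (∀ x ∈ S, 0 ≤ distanceGain c x) →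
      ∑ x ∈ S, wordWeight p x ≤ e) :
    ∑ x ∈ Gᶜ, wordWeight p x ≤ Nat.card C * e := by
  classical
  let T : C → Finset (Fin n → F) := fun c =>
    Finset.univ.filter fun x => (c : Fin n → F) ≠ 0 ∧ 0 ≤ distanceGain (c : Fin n → F) x
  have hTmem : ∀ (c : C) (x : Fin n → F),
      x ∈ T c ↔ (c : Fin n → F) ≠ 0 ∧ 0 ≤ distanceGain (c : Fin n → F) x := fun c x => by
    simp only [T, Finset.mem_filter, Finset.mem_univ, true_and]
  have hsub : ∀ x ∈ Gᶜ, ∃ c, x ∈ T c := by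
    intro x hx
    have hx' : ¬ ∀ c ∈ C, c ≠ 0 → distanceGain c x < 0 := fun h =>
      Finset.mem_compl.1 hx (hG x h)
    push Not at hx'
    obtain ⟨c, hc, hc0, hle⟩ := hx'
    exact ⟨⟨c, hc⟩, (hTmem _ _).2 ⟨hc0, hle⟩⟩
  have hT : ∀ c : C, ∑ x ∈ T c, wordWeight p x ≤ e := by
    intro c
    by_cases hc0 : (c : Fin n → F) = 0
    · rwa [Finset.sum_eq_zero fun x hx => absurd hc0 ((hTmem c x).1 hx).1]
    · exact h c c.2 hc0 _ fun x hx => ((hTmem c x).1 hx).2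
  have hterm : ∀ (c : C) (x : Fin n → F), 0 ≤ if x ∈ T c then wordWeight p x else 0 := fun c x => by
    split_ifs
    exacts [wordWeight_nonneg hp x, le_rfl]
  calc ∑ x ∈ Gᶜ, wordWeight p x
      ≤ ∑ x ∈ Gᶜ, ∑ c : C, if x ∈ T c then wordWeight p x else 0 := by
        refine Finset.sum_le_sum fun x hx => ?_
        obtain ⟨c, hc⟩ := hsub x hx
        refine le_trans ?_ (Finset.single_le_sum
          (f := fun c : C => if x ∈ T c then wordWeight p x else 0) (fun c _ => hterm c x)
          (Finset.mem_univ c))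
        exact (if_pos hc).ge
    _ ≤ ∑ x, ∑ c : C, if x ∈ T c then wordWeight p x else 0 :=
        Finset.sum_le_univ_sum_of_nonneg fun x => Finset.sum_nonneg fun c _ => hterm c x
    _ = ∑ c : C, ∑ x ∈ T c, wordWeight p x := by
        rw [Finset.sum_comm]
        simp only [Finset.sum_ite_mem, Finset.univ_inter]
    _ ≤ ∑ c : C, e := Finset.sum_le_sum fun c _ => hT c
    _ = Nat.card C * e := by
        rw [Finset.sum_const, nsmul_eq_mul, Finset.card_univ, Nat.card_eq_fintype_card]

/-- The case in which every wrong symbol is more likely than the right one: then the code is so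
small that the codeword farthest from the received word is the transmitted one. -/
theorem admitsCommunication_of_gap {C : Submodule F (Fin n → F)} {p L γ : ℝ}
    (hp : p ∈ Set.Ioo (0 : ℝ) 1) (hγ : 0 < γ) (hpq : 1 - 1 / (Fintype.card F : ℝ) + γ ≤ p)
    (hn1 : 1 ≤ Real.log n) (hnγ : 7 / Real.log n ≤ γ / 2) (hnγ2 : 64 / γ ^ 2 ≤ Real.log n)
    (hnγ3 : 1 / γ ≤ n) (hp' : p - 7 / Real.log n ∈ Set.Icc (0 : ℝ) 1)
    (hL : IsListDecodable C p L)
    (hd : ∀ c ∈ C, c ≠ 0 → (Fintype.card F : ℝ) ^ 3 / (1 - p) ^ 2 * Real.log (n * L) ^ 4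
      ≤ hammingNorm c) :
    AdmitsCommunication C (p - 7 / Real.log n) hp' (1 / n) := by
  classical
  have hq := one_lt_card_real (F := F)
  have hL1 := one_le_of_isListDecodable hp.1.le hL
  have hn0' : (0 : ℝ) < n := lt_of_lt_of_le (by positivity) hnγ3
  have hn0 : 0 < n := by exact_mod_cast hn0'
  set q : ℝ := (Fintype.card F : ℝ) with hqdef
  set lam := Real.log n with hlam
  set N : ℝ := n * L with hN
  have hnN : (n : ℝ) ≤ N := le_mul_of_one_le_right hn0'.le hL1
  have hN0 : 0 < N := hn0'.trans_le hnN
  set l := Real.log N with hl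
  have hlaml : lam ≤ l := Real.log_le_log hn0' hnN
  have hl1 : 1 ≤ l := hn1.trans hlaml
  have hexpl : Real.exp l = N := Real.exp_log hN0
  set p' := p - 7 / lam with hp'def
  -- Half of `γ` absorbs the shift `7 / lam`; the other half keeps wrong symbols likelier.
  have hgap : 1 - p' + γ / 2 ≤ p' / (q - 1) := by
    have h1 : 1 - 1 / q + γ / 2 ≤ p' := by linarith
    have h2 := mul_le_mul_of_nonneg_right h1 (by linarith : 0 ≤ q)
    rw [add_mul, sub_mul, one_mul, one_div, inv_mul_cancel₀ (by linarith)] at h2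
    rw [le_div_iff₀ (by linarith)]
    linarith
  have hcard : (Nat.card C : ℝ) ≤ N := by
    have h1 := card_mul_le_of_isListDecodable hp.1 hn0 hL
    have h2 : γ ≤ 1 - (1 - 1 / q) / p := by
      have : 1 - (1 - 1 / q) / p = (p - (1 - 1 / q)) / p := by
        have := hp.1.ne'
        field_simp
      rw [this, le_div_iff₀ hp.1]
      nlinarith [hp.2]
    have h3 : (Nat.card C : ℝ) * γ ≤ L :=
      (mul_le_mul_of_nonneg_left h2 (Nat.cast_nonneg _)).trans h1
    calc (Nat.card C : ℝ) ≤ L / γ := (le_div_iff₀ hγ).2 h3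
      _ = 1 / γ * L := by ring
      _ ≤ n * L := by gcongr
  -- The exponent `2 * l` leaves `N * N⁻² ≤ 1 / n` after the union over at most `N` codewords.
  have hexpo : ∀ c ∈ C, c ≠ 0 → 2 * l ≤ (γ / 2) ^ 2 / 8 * hammingNorm c := by
    intro c hc hc0
    have h1 : l ^ 4 ≤ hammingNorm c := by
      refine le_trans (le_mul_of_one_le_left (by positivity) ?_) (hd c hc hc0)
      have h1p : 0 < 1 - p := by linarith [hp.2]
      rw [le_div_iff₀ (by positivity), one_mul]
      exact (pow_le_one₀ h1p.le (by linarith [hp.1])).trans (one_le_pow₀ hq.le)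
    have h2 : 64 ≤ γ ^ 2 * l := by
      have := hnγ2.trans hlaml
      rwa [div_le_iff₀ (by positivity), mul_comm] at this
    have h3 : l ≤ l ^ 3 := by nlinarith [pow_le_pow_right₀ hl1 (show 1 ≤ 3 by norm_num)]
    calc 2 * l ≤ 1 / 32 * (64 * l ^ 3) := by linarith
      _ ≤ 1 / 32 * (γ ^ 2 * l * l ^ 3) := by gcongr
      _ = (γ / 2) ^ 2 / 8 * l ^ 4 := by ring
      _ ≤ _ := by gcongr
  set G : Finset (Fin n → F) := Finset.univ.filter fun x =>
    ∀ c ∈ C, c ≠ 0 → distanceGain c x < 0 with hG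
  refine admitsCommunication_of_coset_unique C hp' G (fun z hz c hc hzc => ?_) ?_
  · by_contra hc0
    simp only [hG, Finset.mem_filter, Finset.mem_univ, true_and, distanceGain_eq] at hz hzc
    have h1 := hz c hc hc0
    have h2 := hzc (-c) (C.neg_mem hc) (neg_ne_zero.2 hc0)
    rw [sub_neg_eq_add, sub_add_cancel] at h2
    linarith
  · have htot := sum_wordWeight (F := F) (n := n) p'
    rw [← Finset.sum_add_sum_compl G] at htot
    have hbad : ∑ x ∈ Gᶜ, wordWeight p' x ≤ 1 / n := by
      calc ∑ x ∈ Gᶜ, wordWeight p' x ≤ Nat.card C * Real.exp (-(2 * l)) :=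
            sum_compl_le_card_mul hp' (Real.exp_pos _).le G
              (fun x hx => Finset.mem_filter.2 ⟨Finset.mem_univ _, hx⟩) fun c hc hc0 S hS =>
              (sum_wordWeight_le_exp_of_gap hp' (half_pos hγ) hgap c S hS).trans
                (Real.exp_le_exp.2 (neg_le_neg (hexpo c hc hc0)))
        _ ≤ N * Real.exp (-(2 * l)) := by gcongr
        _ = 1 / N := by
            rw [eq_div_iff hN0.ne', ← hexpl, ← Real.exp_add, ← Real.exp_add, ← Real.exp_zero]
            congr 1; ring
        _ ≤ 1 / n := by gcongr
    linarith

end Regimes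

/-! ### Constants that depend on `p` alone -/

/-- Only finitely many alphabet sizes `q` satisfy `1 - 1 / q < p`, so `p` is bounded away from all
these values. -/
theorem exists_gap {p : ℝ} (hp : p < 1) :
    ∃ γ : ℝ, 0 < γ ∧ ∀ q : ℕ, 0 < q → 1 - 1 / (q : ℝ) < p → 1 - 1 / (q : ℝ) + γ ≤ p := by
  have hfin : ∀ M : ℕ, ∃ γ : ℝ, 0 < γ ∧
      ∀ q : ℕ, q < M → 1 - 1 / (q : ℝ) < p → 1 - 1 / (q : ℝ) + γ ≤ p := by
    intro M
    induction M with
    | zero => exact ⟨1, one_pos, fun q hq => absurd hq (Nat.not_lt_zero q)⟩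
    | succ M ih =>
      obtain ⟨γ, hγ, h⟩ := ih
      by_cases hM : 1 - 1 / (M : ℝ) < p
      · refine ⟨min γ (p - (1 - 1 / (M : ℝ))), lt_min hγ (by linarith), fun q hq hlt => ?_⟩
        rcases Nat.lt_succ_iff_lt_or_eq.1 hq with hq | rfl
        · linarith [h q hq hlt, min_le_left γ (p - (1 - 1 / (M : ℝ)))]
        · linarith [min_le_right γ (p - (1 - 1 / (q : ℝ)))]
      · refine ⟨γ, hγ, fun q hq hlt => ?_⟩
        rcases Nat.lt_succ_iff_lt_or_eq.1 hq with hq | rfl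
        · exact h q hq hlt
        · exact absurd hlt hM
  obtain ⟨M, hM⟩ := exists_nat_gt (1 / (1 - p))
  obtain ⟨γ, hγ, h⟩ := hfin M
  refine ⟨γ, hγ, fun q hq hlt => h q ?_ hlt⟩
  have hq' : (0 : ℝ) < q := by exact_mod_cast hq
  have h1 : (q : ℝ) < 1 / (1 - p) := by
    rw [lt_div_iff₀ (by linarith)]
    have : 1 - p < 1 / q := by linarith
    rwa [lt_div_iff₀ hq', mul_comm] at this
  exact_mod_cast h1.trans hM

end CodingTheory

theorem theorem2 (p : ℝ) (hp : p ∈ Set.Ioo (0 : ℝ) 1) :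
    ∃ ε : ℕ → ℝ, Filter.Tendsto ε Filter.atTop (nhds 0) ∧
      ∃ n₀ : ℕ, ∀ n : ℕ, n₀ ≤ n →
        ∃ hp' : p - 7 / Real.log n ∈ Set.Icc (0 : ℝ) 1,
          ∀ (F : Type*) [Field F] [Fintype F] [DecidableEq F]
            (L : ℝ) (C : Submodule F (Fin n → F)),
            CodingTheory.IsListDecodable C p L →
            ENNReal.ofReal ((Fintype.card F : ℝ) ^ 3 / (1 - p) ^ 2 * Real.log (n * L) ^ 4)
              ≤ (CodingTheory.minDist C : ENNReal) →
            CodingTheory.AdmitsCommunication C (p - 7 / Real.log n) hp' (ε n) := by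
  refine ⟨fun n => 1 / n, tendsto_one_div_atTop_nhds_zero_nat, ?_⟩
  obtain ⟨γ, hγ, hgap⟩ := CodingTheory.exists_gap hp.2
  have hlog : Filter.Tendsto (fun n : ℕ => Real.log n) Filter.atTop Filter.atTop :=
    Real.tendsto_log_atTop.comp tendsto_natCast_atTop_atTop
  -- In order, the thresholds serve the raising condition, `p' ≥ 0`, the surviving half of the gap,
  -- the exponent of the union bound, and `|C| ≤ n * L`.
  have hev := (hlog.eventually_ge_atTop 121).and ((hlog.eventually_ge_atTop (7 / p)).and
    ((hlog.eventually_ge_atTop (14 / γ)).and ((hlog.eventually_ge_atTop (64 / γ ^ 2)).and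
      ((tendsto_natCast_atTop_atTop (R := ℝ)).eventually_ge_atTop (1 / γ)))))
  obtain ⟨n₀, hn₀⟩ := Filter.eventually_atTop.1 hev
  refine ⟨n₀, fun n hn => ?_⟩
  obtain ⟨h121, h7, h14, h64, hnγ⟩ := hn₀ n hn
  have hpos : 0 < Real.log n := by linarith
  have h7p : 7 / Real.log n ≤ p := by
    rw [div_le_iff₀ hpos, mul_comm]
    exact (div_le_iff₀ hp.1).1 h7
  have h7γ : 7 / Real.log n ≤ γ / 2 := by
    rw [div_le_iff₀ hpos]
    have := (div_le_iff₀ hγ).1 h14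
    linarith
  have h70 : 0 < 7 / Real.log n := by positivity
  refine ⟨⟨by linarith, by linarith [hp.2]⟩, fun F _ _ _ L C hL hd => ?_⟩
  have hd' := fun c hc hc0 => CodingTheory.le_hammingNorm_of_le_minDist (c := c) hd hc hc0
  rcases le_or_gt p (1 - 1 / (Fintype.card F : ℝ)) with h | h
  · exact CodingTheory.admitsCommunication_of_le hp h h121 _ hL hd'
  · exact CodingTheory.admitsCommunication_of_gap hp hγ (hgap _ Fintype.card_pos h)
      (by linarith) h7γ h64 hnγ _ hL hd'
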